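/- Let $a,b,c\in\mathbb R$ satisfy either ($c=0$ and $a\neq b$) or ($c>0$ and $a<b$), and put $Q(x)=ax(x-1)+bx+c$. Let $\nu_0$ be the largest real root of $Q$, and let $\nu>\max\{0,\nu_0\}$ (if $Q$ has no real root, this means only $\nu>0$). Let $$J_\nu(z)=\sum_{n\ge0}\frac{(-1)^n}{n!\,\Gamma(n+\nu+1)}\Big(\frac z2\Big)^{2n+\nu},\qquad N_\nu(z)=az^2J_\nu''(z)+bzJ_\nu'(z)+cJ_\nu(z)=\sum_{n\ge0}\frac{(-1)^nQ(2n+\nu)}{n!\,\Gamma(n+\nu+1)}\Big(\frac z2\Big)^{2n+\nu},$$ and consider the normalized entire functions $$g_\nu(z)=\frac{2^\nu\Gamma(\nu+1)}{Q(\nu)}z^{1-\nu}N_\nu(z),\qquad h_\nu(z)=\frac{2^\nu\Gamma(\nu+1)}{Q(\nu)}z^{1-\nu/2}N_\nu(\sqrt z).$$ For $f\in\{g_\nu,h_\nu\}$ let the radius of starlikeness be $$r^*(f)=\sup\Big\{r>0:\ \operatorname{Re}\frac{zf'(z)}{f(z)}>0\ \text{ for all } |z|<r\Big\}$$ (with the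 value $1$ of the quotient at $z=0$). Then: a) $r^*(g_\nu)$ satisfies $$r^*(g_\nu)<\sqrt{\frac{2(\nu+1)Q(\nu)}{Q(\nu+2)}},$$ $$2\sqrt{\frac{(\nu+1)Q(\nu)}{3Q(\nu+2)}}<r^*(g_\nu)<2\sqrt{\frac{Q(\nu+2)}{\frac{3Q^2(\nu+2)}{(\nu+1)Q(\nu)}-\frac{5Q(\nu+4)}{3(\nu+2)}}},$$ $$\sqrt[4]{\frac{16(\nu+1)^2(\nu+2)Q^2(\nu)}{9(\nu+2)Q^2(\nu+2)-5(\nu+1)Q(\nu)Q(\nu+4)}}<r^*(g_\nu)$$ $$<\sqrt{\frac{8(\nu+1)(\nu+3)Q(\nu)\left[9(\nu+2)Q^2(\nu+2)-5(\nu+1)Q(\nu)Q(\nu+4)\right]}{9(\nu+3)Q(\nu+2)\left[6(\nu+2)Q^2(\nu+2)-5(\nu+1)Q(\nu)Q(\nu+4)\right]+7(\nu+1)^2Q^2(\nu)Q(\nu+6)}}.$$ b) $r^*(h_\nu)$ satisfies $$r^*(h_\nu)<\frac{4(\nu+1)Q(\nu)}{Q(\nu+2)},$$ $$\frac{2(\nu+1)Q(\nu)}{3Q(\nu+2)}<r^*(h_\nu),\qquad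 \frac{2(\nu+1)Q(\nu)}{Q(\nu+2)}<r^*(h_\nu)<\frac{2Q(\nu+2)}{\frac{Q^2(\nu+2)}{(\nu+1)Q(\nu)}-\frac{3Q(\nu+4)}{4(\nu+2)}},$$ $$\sqrt{\frac{4(\nu+1)Q(\nu)}{\frac{Q^2(\nu+2)}{(\nu+1)Q(\nu)}-\frac{3Q(\nu+4)}{4(\nu+2)}}}<r^*(h_\nu)$$ $$<\frac{4(\nu+1)(\nu+3)Q(\nu)\left[4(\nu+2)Q^2(\nu+2)-3(\nu+1)Q(\nu)Q(\nu+4)\right]}{(\nu+3)Q(\nu+2)\left[8(\nu+2)Q^2(\nu+2)-9(\nu+1)Q(\nu)Q(\nu+4)\right]+2(\nu+1)^2Q^2(\nu)Q(\nu+6)}.$$ -/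

import Mathlib

open Complex

/-- The quadratic `Q(x) = a x (x - 1) + b x + c`. -/
def mercerQ (a b c x : ℝ) : ℝ := a * x * (x - 1) + b * x + c

/-- The Bessel function of the first kind of real order `ν`, on the principal branch:
`J_ν(z) = ∑ (-1)^n / (n! Γ(n + ν + 1)) (z / 2)^(2 n + ν)`. -/
noncomputable def besselJ (ν : ℝ) (z : ℂ) : ℂ :=
  ∑' n : ℕ, (((-1) ^ n / ((n.factorial : ℝ) * Real.Gamma (n + ν + 1)) : ℝ) : ℂ) *
    (z / 2) ^ (((2 * n + ν : ℝ)) : ℂ)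

/-- The function `N_ν(z) = a z² J_ν''(z) + b z J_ν'(z) + c J_ν(z)`, given by its series, which
(unlike complex derivatives of a principal branch) also has the right values on the branch cut.
See `mercerN_eq` for the equality with the combination of derivatives of `J_ν`. -/
noncomputable def mercerN (a b c ν : ℝ) (z : ℂ) : ℂ :=
  ∑' n : ℕ, ((mercerQ a b c (2 * n + ν) * (-1) ^ n /
      ((n.factorial : ℝ) * Real.Gamma (n + ν + 1)) : ℝ) : ℂ) *
    (z / 2) ^ (((2 * n + ν : ℝ)) : ℂ)

/-- `g_ν(z) = 2^ν Γ(ν + 1) z^(1 - ν) N_ν(z) / Q(ν)`. -/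
noncomputable def mercerG (a b c ν : ℝ) (z : ℂ) : ℂ :=
  ((2 ^ ν * Real.Gamma (ν + 1) / mercerQ a b c ν : ℝ) : ℂ) * z ^ ((1 - ν : ℝ) : ℂ) *
    mercerN a b c ν z

/-- `h_ν(z) = 2^ν Γ(ν + 1) z^(1 - ν / 2) N_ν(√z) / Q(ν)`. -/
noncomputable def mercerH (a b c ν : ℝ) (z : ℂ) : ℂ :=
  ((2 ^ ν * Real.Gamma (ν + 1) / mercerQ a b c ν : ℝ) : ℂ) * z ^ ((1 - ν / 2 : ℝ) : ℂ) *
    mercerN a b c ν (z ^ (1 / 2 : ℂ))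

/-- The radius of starlikeness of order `β` of `f` (for `f` normalized by `f 0 = 0`, `f' 0 = 1`):
the supremum of the radii `r > 0` such that `f` is analytic in the disk `|z| < r` and
`Re (z f'(z) / f(z)) > β` there. The quotient has a removable singularity at `z = 0`, with
value `1`, so the origin is left out; a zero `z ≠ 0` of `f` violates the inequality for `β ≥ 0`. -/
noncomputable def starlikeRadius (β : ℝ) (f : ℂ → ℂ) : ℝ :=
  sSup {r : ℝ | 0 < r ∧ DifferentiableOn ℂ f (Metric.ball 0 r) ∧
    ∀ z ∈ Metric.ball (0 : ℂ) r, z ≠ 0 → β < (z * deriv f z / f z).re}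

theorem bessel_summable_step {ν : ℝ} (hν : 0 < ν) {d : ℕ → ℝ}
    (hd : ∀ x : ℝ, 0 ≤ x → Summable fun n => |d n| * x ^ n) (x : ℝ) (hx : 0 ≤ x) :
    Summable fun n : ℕ => |(2 * n + ν) * d n| * x ^ n := by
  refine Summable.of_nonneg_of_le (fun n => by positivity) (fun n => ?_)
    ((hd (2 * x) (by positivity)).mul_left (2 + ν))
  have h1 : (n : ℝ) ≤ 2 ^ n := by exact_mod_cast n.lt_two_pow_self.le
  have h2 : (1 : ℝ) ≤ 2 ^ n := one_le_pow₀ (by norm_num)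
  have h3 : (2 * n + ν : ℝ) ≤ (2 + ν) * 2 ^ n := by nlinarith
  rw [abs_mul, abs_of_pos (show (0 : ℝ) < 2 * n + ν by positivity), mul_pow]
  calc (2 * n + ν) * |d n| * x ^ n = (2 * n + ν) * (|d n| * x ^ n) := by ring
    _ ≤ ((2 + ν) * 2 ^ n) * (|d n| * x ^ n) := by gcongr
    _ = _ := by ring

theorem bessel_norm_bound {ν : ℝ} (hν : 0 < ν) (d : ℝ) (n : ℕ) {R : ℝ} {w : ℂ}
    (hw : ‖w‖ ≤ R) :
    ‖(d : ℂ) * (w / 2) ^ (((2 * n + ν : ℝ)) : ℂ)‖ ≤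
      (R / 2) ^ ν * (|d| * ((R / 2) ^ 2) ^ n) := by
  have hp : (0 : ℝ) < 2 * n + ν := by positivity
  have hR : 0 ≤ R := (norm_nonneg _).trans hw
  rw [norm_mul, Complex.norm_real, Real.norm_eq_abs]
  have h1 : ‖(w / 2) ^ (((2 * n + ν : ℝ)) : ℂ)‖ = (‖w‖ / 2) ^ (2 * n + ν : ℝ) := by
    rw [Complex.norm_cpow_real]
    simp
  have h2 : (‖w‖ / 2) ^ (2 * n + ν : ℝ) ≤ (R / 2) ^ (2 * n + ν : ℝ) := by gcongr
  have h3 : (R / 2) ^ (2 * n + ν : ℝ) = ((R / 2) ^ 2) ^ n * (R / 2) ^ ν := by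
    rw [Real.rpow_add_of_nonneg (by positivity) (by positivity) hν.le, ← pow_mul]
    congr 1
    exact_mod_cast Real.rpow_natCast (R / 2) (2 * n)
  rw [h1]
  calc |d| * (‖w‖ / 2) ^ (2 * n + ν : ℝ) ≤ |d| * (R / 2) ^ (2 * n + ν : ℝ) := by gcongr
    _ = _ := by rw [h3]; ring

theorem bessel_summable {ν : ℝ} (hν : 0 < ν) {d : ℕ → ℝ}
    (hd : ∀ x : ℝ, 0 ≤ x → Summable fun n => |d n| * x ^ n) (z : ℂ) :
    Summable fun n : ℕ => (d n : ℂ) * (z / 2) ^ (((2 * n + ν : ℝ)) : ℂ) :=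
  Summable.of_norm_bounded ((hd _ (sq_nonneg (‖z‖ / 2))).mul_left _)
    fun n => bessel_norm_bound hν (d n) n le_rfl

/-- Termwise application of `z d/dz`. -/
theorem bessel_euler_step {ν : ℝ} (hν : 0 < ν) {d : ℕ → ℝ}
    (hd : ∀ x : ℝ, 0 ≤ x → Summable fun n => |d n| * x ^ n) {z : ℂ} (hz : z ∈ slitPlane) :
    HasDerivAt (fun w : ℂ => ∑' n : ℕ, (d n : ℂ) * (w / 2) ^ (((2 * n + ν : ℝ)) : ℂ))
      ((∑' n : ℕ, (((2 * n + ν) * d n : ℝ) : ℂ) * (z / 2) ^ (((2 * n + ν : ℝ)) : ℂ)) / z) z := by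
  set R := ‖z‖ + 1
  set U : Set ℂ := slitPlane ∩ Metric.ball 0 R
  have hU : IsOpen U := isOpen_slitPlane.inter Metric.isOpen_ball
  have hzU : z ∈ U := ⟨hz, by simp [R]⟩
  have hF : ∀ n : ℕ, ∀ w ∈ slitPlane,
      HasDerivAt (fun w : ℂ => (d n : ℂ) * (w / 2) ^ (((2 * n + ν : ℝ)) : ℂ))
        ((((2 * n + ν) * d n : ℝ) : ℂ) * (w / 2) ^ (((2 * n + ν : ℝ)) : ℂ) / w) w := by
    intro n w hw
    have hw0 : w ≠ 0 := slitPlane_ne_zero hw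
    have hw2 : w / 2 ∈ slitPlane := by
      rw [mem_slitPlane_iff] at hw ⊢
      simpa using hw
    have := (((hasDerivAt_id w).div_const 2).cpow_const
      (c := (((2 * n + ν : ℝ)) : ℂ)) hw2).const_mul (d n : ℂ)
    refine this.congr_deriv ?_
    simp only [id]
    rw [Complex.cpow_sub _ _ (by simpa using hw0), Complex.cpow_one]
    push_cast
    field_simp
  have hu := (hd _ (sq_nonneg (R / 2))).mul_left ((R / 2) ^ ν)
  have hdiff : ∀ n : ℕ, DifferentiableOn ℂ
      (fun w : ℂ => (d n : ℂ) * (w / 2) ^ (((2 * n + ν : ℝ)) : ℂ)) U :=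
    fun n w hw => (hF n w hw.1).differentiableAt.differentiableWithinAt
  have hle : ∀ (n : ℕ) (w : ℂ), w ∈ U →
      ‖(d n : ℂ) * (w / 2) ^ (((2 * n + ν : ℝ)) : ℂ)‖ ≤
        (R / 2) ^ ν * (|d n| * ((R / 2) ^ 2) ^ n) :=
    fun n w hw => bessel_norm_bound hν (d n) n (mem_ball_zero_iff.mp hw.2).le
  have h1 := (differentiableOn_tsum_of_summable_norm hu hdiff hU hle).differentiableAt
    (hU.mem_nhds hzU)
  have h2 := hasSum_deriv_of_summable_norm hu hdiff hU hle hzU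
  refine h1.hasDerivAt.congr_deriv ?_
  rw [← h2.tsum_eq, ← tsum_div_const]
  exact tsum_congr fun n => (hF n z hz).deriv

/-- Off the branch cut, `N_ν = a z² J_ν'' + b z J_ν' + c J_ν`. -/
theorem mercerN_eq (a b c : ℝ) {ν : ℝ} (hν : 0 < ν) {z : ℂ} (hz : z ∈ slitPlane) :
    mercerN a b c ν z = a * z ^ 2 * deriv (deriv (besselJ ν)) z + b * z * deriv (besselJ ν) z +
      c * besselJ ν z := by
  set d : ℕ → ℝ := fun n => (-1) ^ n / ((n.factorial : ℝ) * Real.Gamma (n + ν + 1)) with hd_def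
  have hd : ∀ x : ℝ, 0 ≤ x → Summable fun n => |d n| * x ^ n := by
    intro x hx
    refine Summable.of_nonneg_of_le (fun n => by positivity) (fun n => ?_)
      ((Real.summable_pow_div_factorial x).mul_left (1 / Real.Gamma (ν + 1)))
    have hG0 : 0 < Real.Gamma (ν + 1) := Real.Gamma_pos_of_pos (by linarith)
    have hG : ∀ m : ℕ, Real.Gamma (ν + 1) ≤ Real.Gamma (m + ν + 1) := by
      intro m
      induction m with
      | zero => simp
      | succ k ih =>
        have hk : (0 : ℝ) < k + ν + 1 := by positivity
        have : ((k + 1 : ℕ) : ℝ) + ν + 1 = (k + ν + 1) + 1 := by push_cast; ring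
        rw [this, Real.Gamma_add_one hk.ne']
        have h1 : (1 : ℝ) ≤ k + ν + 1 := by
          have : (0 : ℝ) ≤ k := k.cast_nonneg
          linarith
        nlinarith
    have hGn := hG n
    have hfac : (0 : ℝ) < n.factorial := by positivity
    have : |d n| = 1 / ((n.factorial : ℝ) * Real.Gamma (n + ν + 1)) := by
      simp only [hd_def, abs_div, abs_pow, abs_neg, abs_one, one_pow]
      rw [abs_of_pos (mul_pos hfac (hG0.trans_le hGn))]
    rw [this]
    calc 1 / ((n.factorial : ℝ) * Real.Gamma (n + ν + 1)) * x ^ n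
        ≤ 1 / ((n.factorial : ℝ) * Real.Gamma (ν + 1)) * x ^ n := by gcongr
      _ = _ := by field_simp
  have hd1 := bessel_summable_step hν hd
  have hd2 := bessel_summable_step hν hd1
  set J1 : ℂ → ℂ := fun w =>
    ∑' n : ℕ, (((2 * n + ν) * d n : ℝ) : ℂ) * (w / 2) ^ (((2 * n + ν : ℝ)) : ℂ) with hJ1
  set J2 : ℂ := ∑' n : ℕ, (((2 * n + ν) * ((2 * n + ν) * d n) : ℝ) : ℂ) *
    (z / 2) ^ (((2 * n + ν : ℝ)) : ℂ) with hJ2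
  have hz0 : z ≠ 0 := slitPlane_ne_zero hz
  have e1 : ∀ w ∈ slitPlane, deriv (besselJ ν) w = J1 w / w :=
    fun w hw => (bessel_euler_step hν hd hw).deriv
  have e2 : HasDerivAt J1 (J2 / z) z := bessel_euler_step hν hd1 hz
  have e3 : deriv (deriv (besselJ ν)) z = (J2 / z * z - J1 z * 1) / z ^ 2 := by
    have : deriv (besselJ ν) =ᶠ[nhds z] fun w => J1 w / w := by
      filter_upwards [isOpen_slitPlane.mem_nhds hz] with w hw using e1 w hw
    rw [this.deriv_eq]
    exact (e2.div (hasDerivAt_id z) hz0).deriv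
  have s0 := (bessel_summable hν hd z).hasSum
  have s1 := (bessel_summable hν hd1 z).hasSum
  have s2 := (bessel_summable hν hd2 z).hasSum
  have hs := ((s2.mul_left (a : ℂ)).add (s1.mul_left ((b : ℂ) - a))).add (s0.mul_left (c : ℂ))
  have hN : mercerN a b c ν z = a * J2 + (b - a) * J1 z + c * besselJ ν z := by
    refine Eq.trans (tsum_congr fun n => ?_) hs.tsum_eq
    simp only [hd_def, mercerQ]
    push_cast
    ring
  rw [hN, e3, e1 z hz]
  field_simp
  ring

open Filter Topology

/-! With `m = 2` for `g_ν` and `m = 1` for `h_ν`, the function is `z T(z ^ m)`, where `T` has the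
coefficients `Q(2k + ν) / Q(ν) * besselCoeff ν k`, and `z f' / f = F(z ^ m) / T(z ^ m)` with `F = T
+ m z T'`. The power series `T` and `F` are limits of polynomials `∏ (1 - u X)` with `u ≥ 0`.
Instead of factoring the entire functions into infinite products, the proof works with these
polynomials and passes to the limit in inequalities and in power sums of the `u`.

Membership in this class: rescaled Laguerre polynomials converge to the Bessel series, and the
operators `1 + s X d/dX - b X` with `s, b ≥ 0` preserve positive roots
(`exists_posProd_eq_add_derivative`); they build the Laguerre polynomials, introduce the weight `Q`,
and lead from `T` to `F` (`exists_laguerre`, `exists_mercer_limit`).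

The radius: `F / T` is `1 - m ∑ u w / (1 - u w)` for a polynomial `T`, and on `|w| = r` its real
part is at least its value at `r`. Hence `ρ ^ m` is the first positive zero `y` of `F`
(`IsPosProdLimit.starlikeRadius_eq`).

The bounds: if `τ k` are the power sums attached to `F`, then `1 < τ 1 * y`, `1 < τ 2 * y ^ 2`, `y *
τ 2 < τ 1` and `y * τ 3 < τ 2` (`exists_first_zero`), and Newton's identities compute `τ 1, τ 2, τ
3` from the coefficients. The remaining upper bound is `m * σ 1 * y < 1` with the power sum `σ 1` of
`T` (`first_zero_euler`). Strictness is the delicate point: equality would make all nonzero `u`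
coincide in the limit, so that the series would solve a first-order recursion incompatible with
decay like `1 / (k!)²` (`quadratic_ne_zero`). -/

/-! ### Polynomials with positive roots and operators preserving them. -/

/-- The polynomial `∏ (1 - u X)` over a multiset of numbers `u`. -/
noncomputable def posProd (U : Multiset ℝ) : Polynomial ℝ :=
  (U.map fun u => 1 - Polynomial.C u * Polynomial.X).prod

theorem posProd_zero : posProd 0 = 1 := by simp [posProd]

theorem posProd_cons (u : ℝ) (U : Multiset ℝ) :
    posProd (u ::ₘ U) = (1 - Polynomial.C u * Polynomial.X) * posProd U := by simp [posProd]

theorem posProd_eval (U : Multiset ℝ) (t : ℝ) :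
    (posProd U).eval t = (U.map fun u => 1 - u * t).prod := by
  induction U using Multiset.induction with
  | empty => simp [posProd_zero]
  | cons u U ih => simp [posProd_cons, ih]

theorem posProd_aeval (U : Multiset ℝ) (z : ℂ) :
    Polynomial.aeval z (posProd U) = (U.map fun u : ℝ => 1 - (u : ℂ) * z).prod := by
  induction U using Multiset.induction with
  | empty => simp [posProd_zero]
  | cons u U ih => simp [posProd_cons, ih]

theorem posProd_coeff_zero (U : Multiset ℝ) : (posProd U).coeff 0 = 1 := by
  rw [Polynomial.coeff_zero_eq_eval_zero, posProd_eval]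
  simp

/-- In `p' / p = -∑ u / (1 - u z)` each term is expanded by the conjugate of its denominator, so `A
= ∑ u / |1 - u z|²` and `B = ∑ u² / |1 - u z|²`. At a root of `p + s z p' - b z p` this gives `1 + s
|z|² B = z (s A + b)`, which forces `z` to be real and positive, without Rolle's theorem or counting
of multiplicities. -/
theorem posProd_aeval_derivative {U : Multiset ℝ} (hU : ∀ u ∈ U, 0 ≤ u) {z : ℂ}
    (hz : Polynomial.aeval z (posProd U) ≠ 0) :
    ∃ A B : ℝ, 0 ≤ A ∧ 0 ≤ B ∧ Polynomial.aeval z (Polynomial.derivative (posProd U)) =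
      -Polynomial.aeval z (posProd U) * (A - starRingEnd ℂ z * B) := by
  induction U using Multiset.induction with
  | empty => exact ⟨0, 0, le_rfl, le_rfl, by simp [posProd_zero]⟩
  | cons u U ih =>
    rw [posProd_cons] at hz ⊢
    rw [map_mul] at hz
    obtain ⟨h1, h2⟩ := mul_ne_zero_iff.mp hz
    obtain ⟨A, B, hA, hB, h⟩ := ih (fun v hv => hU v (Multiset.mem_cons_of_mem hv)) h2
    have hu : 0 ≤ u := hU u (Multiset.mem_cons_self _ _)
    have h1' : 1 - (u : ℂ) * z ≠ 0 := by simpa using h1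
    have hN : Complex.normSq (1 - (u : ℂ) * z) ≠ 0 := by simpa using h1'
    refine ⟨A + u / Complex.normSq (1 - (u : ℂ) * z), B + u ^ 2 / Complex.normSq (1 - (u : ℂ) * z),
      add_nonneg hA (div_nonneg hu (Complex.normSq_nonneg _)),
      add_nonneg hB (div_nonneg (sq_nonneg _) (Complex.normSq_nonneg _)), ?_⟩
    have key : ((Complex.normSq (1 - (u : ℂ) * z) : ℝ) : ℂ) =
        (1 - (u : ℂ) * z) * (1 - (u : ℂ) * starRingEnd ℂ z) := by
      rw [Complex.normSq_eq_conj_mul_self]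
      simp [mul_comm]
    have h3 : 1 - (u : ℂ) * starRingEnd ℂ z ≠ 0 := by
      intro h0
      apply hN
      have : ((Complex.normSq (1 - (u : ℂ) * z) : ℝ) : ℂ) = 0 := by rw [key, h0, mul_zero]
      exact_mod_cast this
    simp only [Polynomial.derivative_mul, map_add, map_mul, h]
    simp only [map_sub, map_one, Polynomial.derivative_one, Polynomial.derivative_mul,
      Polynomial.derivative_C, Polynomial.derivative_X, map_mul, Polynomial.aeval_C,
      Polynomial.aeval_X, Complex.coe_algebraMap, zero_mul, mul_one, zero_add, zero_sub,
      map_neg]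
    push_cast
    rw [key]
    field_simp
    ring

/-- A real polynomial with constant coefficient `1` all of whose complex roots are positive reals
is of the form `∏ (1 - u X)` with `u ≥ 0`. -/
theorem exists_posProd_eq {R : Polynomial ℝ} (h0 : R.coeff 0 = 1)
    (hR : ∀ z : ℂ, Polynomial.aeval z R = 0 → ∃ x : ℝ, 0 < x ∧ z = x) :
    ∃ U : Multiset ℝ, (∀ u ∈ U, 0 ≤ u) ∧ R = posProd U := by
  set S := R.map (algebraMap ℝ ℂ) with hS
  have hS0 : S.eval 0 = 1 := by
    rw [← Polynomial.coeff_zero_eq_eval_zero, hS, Polynomial.coeff_map, h0, map_one]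
  have hSne : S ≠ 0 := by
    rintro h
    simp [h] at hS0
  have hroot : ∀ z ∈ S.roots, ∃ x : ℝ, 0 < x ∧ z = x := by
    intro z hz
    apply hR
    rw [Polynomial.mem_roots hSne, Polynomial.IsRoot, hS, Polynomial.eval_map] at hz
    rw [Polynomial.aeval_def, hz]
  have hgen : ∀ Z : Multiset ℂ, (∀ z ∈ Z, ∃ x : ℝ, 0 < x ∧ z = x) →
      (Z.map fun z => Polynomial.X - Polynomial.C z).prod =
        Polynomial.C ((Z.map fun z => -z).prod) *
          (posProd (Z.map fun z => (z.re)⁻¹)).map (algebraMap ℝ ℂ) := by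
    intro Z
    induction Z using Multiset.induction with
    | empty => simp [posProd_zero]
    | cons z Z ih =>
      intro h
      obtain ⟨x, hx, rfl⟩ := h z (Multiset.mem_cons_self _ _)
      rw [Multiset.map_cons, Multiset.prod_cons, ih fun w hw => h w (Multiset.mem_cons_of_mem hw),
        Multiset.map_cons, Multiset.map_cons, Multiset.prod_cons, posProd_cons]
      have : (Polynomial.X - Polynomial.C (x : ℂ)) = Polynomial.C (-(x : ℂ)) *
          (1 - Polynomial.C ((x : ℂ)⁻¹) * Polynomial.X) := by
        rw [mul_sub, mul_one, ← mul_assoc, ← Polynomial.C_mul, neg_mul, mul_inv_cancel₀]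
        · simp only [map_neg, map_one]
          ring
        · exact_mod_cast hx.ne'
      rw [this]
      simp only [Polynomial.map_mul, Polynomial.map_sub, Polynomial.map_one, Polynomial.map_C,
        Polynomial.map_X, Polynomial.C_mul, Complex.coe_algebraMap, Complex.ofReal_re,
        Complex.ofReal_inv]
      ring
  refine ⟨S.roots.map fun z => (z.re)⁻¹, ?_, ?_⟩
  · intro u hu
    obtain ⟨z, hz, rfl⟩ := Multiset.mem_map.mp hu
    obtain ⟨x, hx, rfl⟩ := hroot z hz
    simpa using hx.le
  · apply Polynomial.map_injective (algebraMap ℝ ℂ) (algebraMap ℝ ℂ).injective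
    have h1 := (IsAlgClosed.splits S).eq_prod_roots
    rw [hgen _ hroot, ← mul_assoc, ← Polynomial.C_mul] at h1
    have h2 := congrArg (Polynomial.eval 0) h1
    rw [hS0, Polynomial.eval_mul, Polynomial.eval_C, ← Polynomial.coeff_zero_eq_eval_zero,
      Polynomial.coeff_map, posProd_coeff_zero, map_one, mul_one] at h2
    rw [← h2, Polynomial.C_1, one_mul] at h1
    exact h1

/-- `1 + s X d/dX - b X` with `s, b ≥ 0` preserves the polynomials with positive roots. -/
theorem exists_posProd_eq_add_derivative {U : Multiset ℝ} (hU : ∀ u ∈ U, 0 ≤ u) {s b : ℝ}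
    (hs : 0 ≤ s) (hb : 0 ≤ b) :
    ∃ V : Multiset ℝ, (∀ u ∈ V, 0 ≤ u) ∧ posProd U +
      Polynomial.C s * (Polynomial.X * Polynomial.derivative (posProd U)) -
        Polynomial.C b * (Polynomial.X * posProd U) = posProd V := by
  refine exists_posProd_eq (by simp [posProd_coeff_zero]) fun z hz => ?_
  have hz0 : z ≠ 0 := by
    rintro rfl
    simp [posProd_aeval] at hz
  by_cases hp : Polynomial.aeval z (posProd U) = 0
  · rw [posProd_aeval, Multiset.prod_eq_zero_iff, Multiset.mem_map] at hp
    obtain ⟨u, hu, h⟩ := hp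
    have hu0 : u ≠ 0 := by
      rintro rfl
      simp at h
    refine ⟨u⁻¹, inv_pos.mpr ((hU u hu).lt_of_ne' hu0), ?_⟩
    rw [Complex.ofReal_inv]
    exact eq_inv_of_mul_eq_one_right (sub_eq_zero.mp h).symm
  · obtain ⟨A, B, hA, hB, h⟩ := posProd_aeval_derivative hU hp
    simp only [map_add, map_sub, map_mul, Polynomial.aeval_C, Polynomial.aeval_X, h,
      Complex.coe_algebraMap] at hz
    have h1 : (Polynomial.aeval z (posProd U)) *
        ((1 + s * (Complex.normSq z * B)) - z * (s * A + b)) = 0 := by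
      rw [Complex.normSq_eq_conj_mul_self]
      linear_combination hz
    have h2 : ((1 + s * (Complex.normSq z * B) : ℝ) : ℂ) = z * ((s * A + b : ℝ) : ℂ) := by
      push_cast
      exact sub_eq_zero.mp ((mul_eq_zero.mp h1).resolve_left hp)
    have hpos : 0 < 1 + s * (Complex.normSq z * B) := by
      have := Complex.normSq_nonneg z
      positivity
    have hne : s * A + b ≠ 0 := by
      intro h0
      rw [h0, Complex.ofReal_zero, mul_zero] at h2
      exact hpos.ne' (by exact_mod_cast h2)
    have hpos' : 0 < s * A + b := lt_of_le_of_ne (by positivity) hne.symm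
    refine ⟨_, div_pos hpos hpos', ?_⟩
    rw [Complex.ofReal_div, h2, mul_div_assoc, div_self (by exact_mod_cast hne), mul_one]

/-! ### Power sums, Newton's identities and coefficient bounds. -/

/-- Power sums. -/
noncomputable def powSum (U : Multiset ℝ) (k : ℕ) : ℝ := (U.map (· ^ k)).sum

theorem powSum_cons (u : ℝ) (U : Multiset ℝ) (k : ℕ) :
    powSum (u ::ₘ U) k = u ^ k + powSum U k := by simp [powSum]

theorem powSum_nonneg {U : Multiset ℝ} (hU : ∀ u ∈ U, 0 ≤ u) (k : ℕ) : 0 ≤ powSum U k := by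
  refine Multiset.sum_nonneg fun x hx => ?_
  obtain ⟨u, hu, rfl⟩ := Multiset.mem_map.mp hx
  exact pow_nonneg (hU u hu) k

theorem pow_le_powSum {U : Multiset ℝ} (hU : ∀ u ∈ U, 0 ≤ u) (k : ℕ) {u : ℝ} (hu : u ∈ U) :
    u ^ k ≤ powSum U k := by
  obtain ⟨V, rfl⟩ := Multiset.exists_cons_of_mem hu
  rw [powSum_cons]
  linarith [powSum_nonneg (fun v hv => hU v (Multiset.mem_cons_of_mem hv)) k]

/-- Newton's identities as the logarithmic derivative of a power series. -/
theorem posProd_derivative (U : Multiset ℝ) :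
    PowerSeries.derivative ℝ (posProd U : PowerSeries ℝ) =
      -(posProd U : PowerSeries ℝ) * PowerSeries.mk fun k => powSum U (k + 1) := by
  induction U using Multiset.induction with
  | empty =>
    have : (PowerSeries.mk fun k => powSum 0 (k + 1)) = 0 := by
      ext k
      simp [powSum]
    simp [posProd_zero, this]
  | cons u U ih =>
    set G : PowerSeries ℝ := PowerSeries.mk fun k => u ^ (k + 1)
    have hG : (1 - PowerSeries.C u * PowerSeries.X) * G = PowerSeries.C u := by
      ext k
      rw [sub_mul, one_mul, mul_assoc, map_sub, PowerSeries.coeff_C_mul]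
      cases k with
      | zero => simp [G]
      | succ k => simp [G, PowerSeries.coeff_succ_X_mul]; ring
    have hS : (PowerSeries.mk fun k => powSum (u ::ₘ U) (k + 1)) =
        G + PowerSeries.mk fun k => powSum U (k + 1) := by
      ext k
      simp [G, powSum_cons]
    have hD : PowerSeries.derivative ℝ (1 - PowerSeries.C u * PowerSeries.X : PowerSeries ℝ) =
        -PowerSeries.C u := by
      simp
    rw [posProd_cons, hS]
    simp only [Polynomial.coe_mul, Polynomial.coe_sub, Polynomial.coe_one, Polynomial.coe_C,
      Polynomial.coe_X]
    rw [Derivation.leibniz, hD, ih]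
    simp only [smul_eq_mul]
    linear_combination (posProd U : PowerSeries ℝ) * hG

theorem posProd_newton (U : Multiset ℝ) (k : ℕ) :
    (k + 1) * (posProd U).coeff (k + 1) = -∑ ij ∈ Finset.HasAntidiagonal.antidiagonal k,
      (posProd U).coeff ij.1 * powSum U (ij.2 + 1) := by
  have := congrArg (PowerSeries.coeff k) (posProd_derivative U)
  rw [PowerSeries.coeff_derivative, neg_mul, map_neg, PowerSeries.coeff_mul] at this
  simp only [Polynomial.coeff_coe, PowerSeries.coeff_mk] at this
  rw [← this]
  ring

/-- The absolute coefficients are those of `∏ (1 + u X)`, and `∏ (1 + u R) ≤ exp (∑ u R)`. Only the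
first power sum enters, so the bound is uniform along a sequence for which that sum converges. -/
theorem posProd_coeff_bound {U : Multiset ℝ} (hU : ∀ u ∈ U, 0 ≤ u) {R : ℝ} (hR : 0 ≤ R) (k : ℕ) :
    |(posProd U).coeff k| * R ^ k ≤ Real.exp (powSum U 1 * R) := by
  induction U using Multiset.induction generalizing k with
  | empty =>
    rw [posProd_zero, Polynomial.coeff_one]
    split_ifs with h <;> simp [h, powSum]
  | cons u U ih =>
    have hu : 0 ≤ u := hU u (Multiset.mem_cons_self _ _)
    have ih' := ih fun v hv => hU v (Multiset.mem_cons_of_mem hv)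
    have hE := Real.add_one_le_exp (u * R)
    have h0 : Real.exp (powSum (u ::ₘ U) 1 * R) =
        Real.exp (u * R) * Real.exp (powSum U 1 * R) := by
      rw [powSum_cons, pow_one, add_mul, Real.exp_add]
    rw [h0]
    have hp := Real.exp_nonneg (powSum U 1 * R)
    have huR : 0 ≤ u * R := by positivity
    have hstep : (u * R + 1) * Real.exp (powSum U 1 * R) ≤
        Real.exp (u * R) * Real.exp (powSum U 1 * R) := by gcongr
    refine le_trans ?_ hstep
    rw [posProd_cons]
    cases k with
    | zero =>
      have := ih' 0
      simp only [Polynomial.mul_coeff_zero, Polynomial.coeff_sub, Polynomial.coeff_one_zero,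
        Polynomial.coeff_X_zero, mul_zero, sub_zero, one_mul]
      nlinarith
    | succ k =>
      have h1 := ih' (k + 1)
      have h2 := ih' k
      rw [sub_mul, one_mul, mul_assoc, Polynomial.coeff_sub, Polynomial.coeff_C_mul,
        Polynomial.coeff_X_mul]
      calc |(posProd U).coeff (k + 1) - u * (posProd U).coeff k| * R ^ (k + 1)
          ≤ (|(posProd U).coeff (k + 1)| + u * |(posProd U).coeff k|) * R ^ (k + 1) := by
            gcongr
            refine (abs_sub _ _).trans_eq ?_
            rw [abs_mul, abs_of_nonneg hu]
        _ = |(posProd U).coeff (k + 1)| * R ^ (k + 1) +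
            u * R * (|(posProd U).coeff k| * R ^ k) := by ring
        _ ≤ Real.exp (powSum U 1 * R) + u * R * Real.exp (powSum U 1 * R) := by gcongr
        _ = _ := by ring

/-! ### Limits of polynomials with positive roots. -/

/-- The power series `f` is the coefficientwise limit of the polynomials `∏_{u ∈ U n} (1 - u X)`,
`u ≥ 0`, and `σ k`, for `k ≥ 1`, is the limit of the power sums `∑_{u ∈ U n} u ^ k`. -/
structure IsPosProdLimit (U : ℕ → Multiset ℝ) (f σ : ℕ → ℝ) : Prop where
  nonneg : ∀ n, ∀ u ∈ U n, 0 ≤ u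
  coeff : ∀ k, Tendsto (fun n => (posProd (U n)).coeff k) atTop (𝓝 (f k))
  pow : ∀ k, Tendsto (fun n => powSum (U n) (k + 1)) atTop (𝓝 (σ (k + 1)))

/-- Since the constant coefficient is `1`, Newton's identity can be solved for the highest power sum
in terms of coefficients and lower power sums; convergence follows by strong induction. -/
theorem exists_isPosProdLimit {U : ℕ → Multiset ℝ} {f : ℕ → ℝ} (hU : ∀ n, ∀ u ∈ U n, 0 ≤ u)
    (hf : ∀ k, Tendsto (fun n => (posProd (U n)).coeff k) atTop (𝓝 (f k))) :
    ∃ σ, IsPosProdLimit U f σ := by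
  have key : ∀ k, ∃ s, Tendsto (fun n => powSum (U n) (k + 1)) atTop (𝓝 s) := by
    intro k
    induction k using Nat.strong_induction_on with
    | _ k ih =>
      choose! s hs using ih
      have h : ∀ n, powSum (U n) (k + 1) = -((k + 1) * (posProd (U n)).coeff (k + 1)) -
          ∑ j ∈ Finset.range k, (posProd (U n)).coeff (k - j) * powSum (U n) (j + 1) := by
        intro n
        rw [posProd_newton, Finset.Nat.sum_antidiagonal_eq_sum_range_succ_mk,
          ← Finset.sum_range_reflect]
        have : ∀ j ∈ Finset.range (k + 1), (posProd (U n)).coeff (k + 1 - 1 - j) *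
            powSum (U n) (k - (k + 1 - 1 - j) + 1) =
            (posProd (U n)).coeff (k - j) * powSum (U n) (j + 1) := by
          intro j hj
          have : j ≤ k := Nat.lt_succ_iff.mp (Finset.mem_range.mp hj)
          congr 2
          omega
        simp only []
        rw [Finset.sum_congr rfl this, Finset.sum_range_succ, Nat.sub_self, posProd_coeff_zero]
        ring
      refine ⟨_, Tendsto.congr (fun n => (h n).symm) (Tendsto.sub ((hf (k + 1)).const_mul _).neg
        (tendsto_finsetSum _ fun j hj => (hf (k - j)).mul (hs j (Finset.mem_range.mp hj))))⟩
  choose s hs using key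
  exact ⟨fun k => s (k - 1), hU, hf, fun k => by simpa using hs k⟩

namespace IsPosProdLimit

variable {U : ℕ → Multiset ℝ} {f σ : ℕ → ℝ}

theorem coeff_zero (h : IsPosProdLimit U f σ) : f 0 = 1 :=
  tendsto_nhds_unique (h.coeff 0) (by simp [posProd_coeff_zero])

theorem newton (h : IsPosProdLimit U f σ) (k : ℕ) :
    (k + 1) * f (k + 1) = -∑ ij ∈ Finset.HasAntidiagonal.antidiagonal k,
      f ij.1 * σ (ij.2 + 1) := by
  refine tendsto_nhds_unique ((h.coeff (k + 1)).const_mul _) ?_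
  simp_rw [posProd_newton]
  exact (tendsto_finsetSum _ fun ij _ => (h.coeff ij.1).mul (h.pow ij.2)).neg

theorem newton_one (h : IsPosProdLimit U f σ) : σ 1 = -f 1 := by
  have := h.newton 0
  simp [h.coeff_zero] at this
  linarith

theorem newton_two (h : IsPosProdLimit U f σ) : σ 2 = f 1 ^ 2 - 2 * f 2 := by
  have := h.newton 1
  simp [Finset.Nat.antidiagonal_succ, h.coeff_zero, h.newton_one] at this
  linarith

theorem newton_three (h : IsPosProdLimit U f σ) :
    σ 3 = -f 1 ^ 3 + 3 * f 1 * f 2 - 3 * f 3 := by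
  have := h.newton 2
  simp [Finset.Nat.antidiagonal_succ, h.coeff_zero, h.newton_one, h.newton_two] at this
  linarith

theorem pow_nonneg (h : IsPosProdLimit U f σ) (k : ℕ) : 0 ≤ σ (k + 1) :=
  ge_of_tendsto' (h.pow k) fun n => powSum_nonneg (h.nonneg n) _

theorem coeff_bound (h : IsPosProdLimit U f σ) {R : ℝ} (hR : 0 ≤ R) (k : ℕ) :
    |f k| * R ^ k ≤ Real.exp (σ 1 * R) :=
  le_of_tendsto_of_tendsto' ((h.coeff k).abs.mul_const _)
    ((Real.continuous_exp.tendsto _).comp ((h.pow 0).mul_const R))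
    fun n => posProd_coeff_bound (h.nonneg n) hR k

end IsPosProdLimit

theorem mul_pow_le_of_bound {a r B : ℝ} {k : ℕ} (h : a * (2 * r) ^ k ≤ B) :
    a * r ^ k ≤ B * (1 / 2) ^ k := by
  have : a * r ^ k = a * (2 * r) ^ k * (1 / 2) ^ k := by
    rw [mul_assoc, ← mul_pow]
    ring_nf
  rw [this]
  gcongr

theorem IsPosProdLimit.summable {U : ℕ → Multiset ℝ} {f σ : ℕ → ℝ} (h : IsPosProdLimit U f σ)
    {r : ℝ} (hr : 0 ≤ r) : Summable fun k => |f k| * r ^ k :=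
  Summable.of_nonneg_of_le (fun k => by positivity)
    (fun k => mul_pow_le_of_bound (h.coeff_bound (by positivity : 0 ≤ 2 * r) k))
    (summable_geometric_two.mul_left _)

/-! ### Sums of power series, uniform convergence and zero-free intervals. -/

/-- The sum of the power series with real coefficients `f`. -/
noncomputable def powerSum (f : ℕ → ℝ) (z : ℂ) : ℂ := ∑' k, (f k : ℂ) * z ^ k

/-- The sum at a real point of the power series with real coefficients `f`. -/
noncomputable def realPowerSum (f : ℕ → ℝ) (t : ℝ) : ℝ := ∑' k, f k * t ^ k

theorem powerSum_ofReal (f : ℕ → ℝ) (t : ℝ) : powerSum f t = realPowerSum f t := by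
  simp [powerSum, realPowerSum, Complex.ofReal_tsum]

theorem summable_powerSum {f : ℕ → ℝ} (hf : ∀ r : ℝ, 0 ≤ r → Summable fun k => |f k| * r ^ k)
    (z : ℂ) : Summable fun k => (f k : ℂ) * z ^ k :=
  Summable.of_norm (by simpa using hf _ (norm_nonneg z))

theorem hasDerivAt_powerSum {f : ℕ → ℝ}
    (hf : ∀ r : ℝ, 0 ≤ r → Summable fun k => |f k| * r ^ k) (z : ℂ) :
    ∃ d : ℂ, HasDerivAt (powerSum f) d z ∧ z * d = powerSum (fun k => k * f k) z := by
  have hz : z ∈ Metric.ball (0 : ℂ) (‖z‖ + 1) := by simp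
  have hdiff : ∀ k : ℕ, DifferentiableOn ℂ (fun w : ℂ => (f k : ℂ) * w ^ k)
      (Metric.ball 0 (‖z‖ + 1)) := fun k => by fun_prop
  have hle : ∀ (k : ℕ) (w : ℂ), w ∈ Metric.ball (0 : ℂ) (‖z‖ + 1) →
      ‖(f k : ℂ) * w ^ k‖ ≤ |f k| * (‖z‖ + 1) ^ k := by
    intro k w hw
    rw [norm_mul, norm_pow, Complex.norm_real, Real.norm_eq_abs]
    gcongr
    exact (mem_ball_zero_iff.mp hw).le
  have hu := hf (‖z‖ + 1) (by positivity)
  have h1 := (differentiableOn_tsum_of_summable_norm hu hdiff Metric.isOpen_ball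
    hle).differentiableAt (Metric.isOpen_ball.mem_nhds hz)
  have h2 := hasSum_deriv_of_summable_norm hu hdiff Metric.isOpen_ball hle hz
  refine ⟨_, h1.hasDerivAt, ?_⟩
  rw [← h2.tsum_eq, ← tsum_mul_left]
  refine tsum_congr fun k => ?_
  have : deriv (fun w : ℂ => (f k : ℂ) * w ^ k) z = f k * (k * z ^ (k - 1)) := by simp
  rw [this]
  cases k with
  | zero => simp
  | succ k =>
    simp only [Nat.add_sub_cancel, pow_succ]
    push_cast
    ring

theorem continuous_realPowerSum {f : ℕ → ℝ}
    (hf : ∀ r : ℝ, 0 ≤ r → Summable fun k => |f k| * r ^ k) : Continuous (realPowerSum f) := by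
  have h : Continuous (powerSum f) := continuous_iff_continuousAt.mpr fun z =>
    (hasDerivAt_powerSum hf z).choose_spec.1.continuousAt
  have : realPowerSum f = fun t : ℝ => (powerSum f t).re := by
    ext t
    rw [powerSum_ofReal, Complex.ofReal_re]
  rw [this]
  exact Complex.continuous_re.comp (h.comp Complex.continuous_ofReal)

theorem polynomial_hasSum (p : Polynomial ℝ) (z : ℂ) :
    HasSum (fun k => (p.coeff k : ℂ) * z ^ k) (Polynomial.aeval z p) := by
  rw [Polynomial.aeval_eq_sum_range]
  have : ∀ k, p.coeff k • z ^ k = (p.coeff k : ℂ) * z ^ k := fun k => Complex.real_smul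
  simp_rw [this]
  refine hasSum_sum_of_ne_finset_zero fun k hk => ?_
  rw [Polynomial.coeff_eq_zero_of_natDegree_lt (by simpa using hk)]
  simp

theorem polynomial_aeval_ofReal (p : Polynomial ℝ) (t : ℝ) :
    Polynomial.aeval (t : ℂ) p = (p.eval t : ℝ) := by
  rw [← Complex.coe_algebraMap, Polynomial.aeval_algebraMap_apply]
  simp

namespace IsPosProdLimit

variable {U : ℕ → Multiset ℝ} {f σ : ℕ → ℝ}

theorem eventually_norm_sub_lt (h : IsPosProdLimit U f σ) {r ε : ℝ} (hr : 0 ≤ r) (hε : 0 < ε) :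
    ∀ᶠ n in atTop, ∀ z : ℂ, ‖z‖ ≤ r →
      ‖Polynomial.aeval z (posProd (U n)) - powerSum f z‖ < ε := by
  -- Coefficient bounds at radius `2 * r` give geometric domination at radius `r`; the first power
  -- sums are eventually below `σ 1 + 1`.
  set B : ℝ := Real.exp ((σ 1 + 1) * (2 * r)) + Real.exp (σ 1 * (2 * r))
  have hS : Summable fun k : ℕ => B * (1 / 2 : ℝ) ^ k := summable_geometric_two.mul_left _
  have hbd : ∀ᶠ n in atTop, ∀ k, |(posProd (U n)).coeff k - f k| * r ^ k ≤ B * (1 / 2) ^ k := by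
    filter_upwards [(h.pow 0).eventually (gt_mem_nhds (lt_add_one (σ 1)))] with n hn k
    refine mul_pow_le_of_bound ?_
    have h1 := posProd_coeff_bound (h.nonneg n) (by positivity : 0 ≤ 2 * r) k
    have h2 := h.coeff_bound (by positivity : 0 ≤ 2 * r) k
    have h3 : Real.exp (powSum (U n) 1 * (2 * r)) ≤ Real.exp ((σ 1 + 1) * (2 * r)) := by
      have : powSum (U n) 1 ≤ σ 1 + 1 := hn.le
      gcongr
    have h4 : |(posProd (U n)).coeff k - f k| * (2 * r) ^ k ≤
        |(posProd (U n)).coeff k| * (2 * r) ^ k + |f k| * (2 * r) ^ k := by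
      rw [← add_mul]
      gcongr
      exact abs_sub _ _
    linarith
  have hlim : Tendsto (fun n => ∑' k, |(posProd (U n)).coeff k - f k| * r ^ k) atTop (𝓝 0) := by
    have := tendsto_tsum_of_dominated_convergence (𝓕 := atTop)
      (f := fun n k => |(posProd (U n)).coeff k - f k| * r ^ k) (g := fun _ => 0) hS
      (fun k => by
        simpa using (((h.coeff k).sub_const (f k)).abs.mul_const (r ^ k)))
      (by
        filter_upwards [hbd] with n hn k
        rw [Real.norm_of_nonneg (by positivity)]
        exact hn k)
    simpa using this
  filter_upwards [hlim.eventually (gt_mem_nhds hε), hbd] with n hn hb z hz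
  refine lt_of_le_of_lt ?_ hn
  have hsum : Summable fun k => |(posProd (U n)).coeff k - f k| * r ^ k :=
    Summable.of_nonneg_of_le (fun k => by positivity) hb hS
  rw [powerSum, ← (polynomial_hasSum (posProd (U n)) z).tsum_eq,
    ← Summable.tsum_sub (polynomial_hasSum _ z).summable
      (summable_powerSum (fun r hr => h.summable hr) z)]
  refine tsum_of_norm_bounded hsum.hasSum fun k => ?_
  rw [← sub_mul, norm_mul, norm_pow, ← Complex.ofReal_sub, Complex.norm_real, Real.norm_eq_abs]
  gcongr

theorem tendsto_aeval (h : IsPosProdLimit U f σ) (z : ℂ) :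
    Tendsto (fun n => Polynomial.aeval z (posProd (U n))) atTop (𝓝 (powerSum f z)) := by
  rw [Metric.tendsto_nhds]
  intro ε hε
  filter_upwards [h.eventually_norm_sub_lt (norm_nonneg z) hε] with n hn
  rw [dist_eq_norm]
  exact hn z le_rfl

theorem tendsto_eval (h : IsPosProdLimit U f σ) (t : ℝ) :
    Tendsto (fun n => (posProd (U n)).eval t) atTop (𝓝 (realPowerSum f t)) := by
  have := (Complex.continuous_re.tendsto _).comp (h.tendsto_aeval t)
  simpa [Function.comp_def, polynomial_aeval_ofReal, powerSum_ofReal] using this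

theorem realPowerSum_zero (h : IsPosProdLimit U f σ) : realPowerSum f 0 = 1 :=
  tendsto_nhds_unique (h.tendsto_eval 0) (by
    simp [← Polynomial.coeff_zero_eq_eval_zero, posProd_coeff_zero])

/-- If the limit has no zeros on `[0, r]`, then the approximants eventually have none either. -/
theorem eventually_mul_lt_one (h : IsPosProdLimit U f σ) {r : ℝ} (hr : 0 ≤ r)
    (hF : ∀ t ∈ Set.Icc 0 r, 0 < realPowerSum f t) :
    ∀ᶠ n in atTop, ∀ u ∈ U n, u * r < 1 := by
  obtain ⟨t₀, ht₀, hmin⟩ := isCompact_Icc.exists_isMinOn (Set.nonempty_Icc.mpr hr)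
    (continuous_realPowerSum (fun r hr => h.summable hr)).continuousOn
  -- The approximants are taken closer to the limit than its minimum on `[0, r]`; a root `u⁻¹` in
  -- this interval would push the limit below that minimum.
  filter_upwards [h.eventually_norm_sub_lt hr (hF t₀ ht₀)] with n hn u hu
  by_contra! hur
  have hr0 : r ≠ 0 := by
    rintro rfl
    linarith
  have hu0 : 0 < u := (h.nonneg n u hu).lt_of_ne' (by
    rintro rfl
    linarith)
  have hmem : u⁻¹ ∈ Set.Icc 0 r := by
    refine ⟨by positivity, ?_⟩
    rw [inv_le_iff_one_le_mul₀ hu0]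
    linarith
  have hz := hn ((u⁻¹ : ℝ) : ℂ) (by
    rw [Complex.norm_real, Real.norm_of_nonneg hmem.1]
    exact hmem.2)
  have h0 : (posProd (U n)).eval u⁻¹ = 0 := by
    rw [posProd_eval, Multiset.prod_eq_zero_iff, Multiset.mem_map]
    exact ⟨u, hu, by rw [mul_inv_cancel₀ hu0.ne', sub_self]⟩
  rw [polynomial_aeval_ofReal, powerSum_ofReal, h0, Complex.ofReal_zero, zero_sub, norm_neg,
    Complex.norm_real, Real.norm_eq_abs] at hz
  exact absurd (lt_of_le_of_lt (le_abs_self _) hz) (not_lt.mpr (hmin hmem))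

/-- If the limit has no zeros on `[0, r]`, its power sums decay at least as `r ^ (-k)`. -/
theorem mul_pow_succ_le (h : IsPosProdLimit U f σ) {r : ℝ} (hr : 0 ≤ r)
    (hF : ∀ t ∈ Set.Icc 0 r, 0 < realPowerSum f t) (k : ℕ) : r * σ (k + 2) ≤ σ (k + 1) := by
  refine le_of_tendsto_of_tendsto ((h.pow (k + 1)).const_mul r) (h.pow k) ?_
  filter_upwards [h.eventually_mul_lt_one hr hF] with n hn
  have : ∀ V : Multiset ℝ, (∀ u ∈ V, 0 ≤ u ∧ u * r < 1) →
      r * powSum V (k + 1 + 1) ≤ powSum V (k + 1) := by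
    intro V
    induction V using Multiset.induction with
    | empty => simp [powSum]
    | cons u V ih =>
      intro hV
      have h1 := ih fun v hv => hV v (Multiset.mem_cons_of_mem hv)
      obtain ⟨hu, hur⟩ := hV u (Multiset.mem_cons_self _ _)
      rw [powSum_cons, powSum_cons]
      have h2 := _root_.pow_nonneg hu (k + 1)
      have h3 : r * u ^ (k + 1 + 1) = u * r * u ^ (k + 1) := by ring
      nlinarith
  exact this _ fun u hu => ⟨h.nonneg n u hu, hn u hu⟩

/-- The limit is positive on `[0, r]` as soon as `σ_k r ^ k < 1` for some `k`. -/
theorem realPowerSum_pos (h : IsPosProdLimit U f σ) {r : ℝ} (hr : 0 ≤ r) {k : ℕ}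
    (hk : σ (k + 1) * r ^ (k + 1) < 1) : 0 < realPowerSum f r := by
  obtain ⟨θ, hθ1, hθ2⟩ := exists_between hk
  have hθ0 : 0 < θ := lt_of_le_of_lt (mul_nonneg (h.pow_nonneg k) (_root_.pow_nonneg hr _)) hθ1
  obtain ⟨η, hη0, hη1, hη⟩ : ∃ η : ℝ, 0 ≤ η ∧ η < 1 ∧ θ ≤ η ^ (k + 1) := by
    refine ⟨θ ^ (1 / ((k + 1 : ℕ) : ℝ)), by positivity,
      Real.rpow_lt_one hθ0.le hθ2 (by positivity), ?_⟩
    rw [← Real.rpow_natCast, ← Real.rpow_mul hθ0.le, one_div_mul_cancel (by positivity),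
      Real.rpow_one]
  have hev : ∀ᶠ n in atTop, powSum (U n) (k + 1) * r ^ (k + 1) < θ :=
    ((h.pow k).mul_const _).eventually (gt_mem_nhds hθ1)
  -- All `u * r` are eventually at most `η < 1`, and `1 - x ≥ exp (-x / (1 - η))` for `0 ≤ x ≤ η`.
  -- The resulting lower bound for the product depends only on the first power sum, so it stays
  -- positive in the limit.
  have hlow : Real.exp (-(σ 1 * (r / (1 - η)))) ≤ realPowerSum f r := by
    refine le_of_tendsto_of_tendsto ((Real.continuous_exp.tendsto _).comp
      ((h.pow 0).mul_const _).neg) (h.tendsto_eval r) ?_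
    filter_upwards [hev] with n hn
    have hle : ∀ u ∈ U n, u * r ≤ η := by
      intro u hu
      have h1 := pow_le_powSum (h.nonneg n) (k + 1) hu
      have h2 : (u * r) ^ (k + 1) ≤ η ^ (k + 1) := by
        rw [mul_pow]
        have : u ^ (k + 1) * r ^ (k + 1) ≤ powSum (U n) (k + 1) * r ^ (k + 1) := by gcongr
        linarith
      exact le_of_pow_le_pow_left₀ (Nat.succ_ne_zero k) hη0 h2
    have : ∀ V : Multiset ℝ, (∀ u ∈ V, 0 ≤ u ∧ u * r ≤ η) →
        Real.exp (-(powSum V 1 * (r / (1 - η)))) ≤ (posProd V).eval r := by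
      intro V
      rw [posProd_eval]
      induction V using Multiset.induction with
      | empty => simp [powSum]
      | cons u V ih =>
        intro hV
        have h1 := ih fun v hv => hV v (Multiset.mem_cons_of_mem hv)
        obtain ⟨hu, hur⟩ := hV u (Multiset.mem_cons_self _ _)
        have h3 : 0 < 1 - u * r := by linarith
        have h2 : Real.exp (-(u * (r / (1 - η)))) ≤ 1 - u * r := by
          rw [Real.exp_neg, inv_le_comm₀ (Real.exp_pos _) h3]
          refine le_trans ?_ (Real.add_one_le_exp _)
          have h4 : u * r / (1 - u * r) ≤ u * (r / (1 - η)) := by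
            rw [← mul_div_assoc]
            have : 0 < 1 - η := by linarith
            gcongr
          have h5 : (1 - u * r)⁻¹ = u * r / (1 - u * r) + 1 := by
            field_simp
            ring
          linarith
        rw [powSum_cons, pow_one, add_mul, neg_add, Real.exp_add, Multiset.map_cons,
          Multiset.prod_cons]
        gcongr
    exact this _ fun u hu => ⟨h.nonneg n u hu, hle u hu⟩
  exact lt_of_lt_of_le (Real.exp_pos _) hlow

end IsPosProdLimit

/-! ### Strict Euler–Rayleigh inequalities at the first zero. -/

namespace IsPosProdLimit

variable {U : ℕ → Multiset ℝ} {f σ : ℕ → ℝ}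

/-- The limit of `∑ u (u - c)²`. -/
theorem quadratic_one_nonneg (h : IsPosProdLimit U f σ) (c : ℝ) :
    0 ≤ σ 3 - 2 * c * σ 2 + c ^ 2 * σ 1 := by
  refine ge_of_tendsto' (((h.pow 2).sub ((h.pow 1).const_mul (2 * c))).add
    ((h.pow 0).const_mul (c ^ 2))) fun n => ?_
  have : ∀ V : Multiset ℝ, (∀ u ∈ V, 0 ≤ u) →
      0 ≤ powSum V 3 - 2 * c * powSum V 2 + c ^ 2 * powSum V 1 := by
    intro V
    induction V using Multiset.induction with
    | empty => simp [powSum]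
    | cons u V ih =>
      intro hV
      have h1 := ih fun v hv => hV v (Multiset.mem_cons_of_mem hv)
      have hu := hV u (Multiset.mem_cons_self _ _)
      simp only [powSum_cons]
      have h2 : 0 ≤ u * (u - c) ^ 2 := by positivity
      linarith
  exact this _ (h.nonneg n)

/-- The limit of `∑ (l u ^ (j + 1) + u (u - c))²`. As a quadratic in `l` it plays the role of
Cauchy–Schwarz: when its constant term vanishes, so does its linear term. -/
theorem quadratic_nonneg (h : IsPosProdLimit U f σ) (c l : ℝ) (j : ℕ) :
    0 ≤ l ^ 2 * σ (2 * j + 2) + 2 * l * (σ (j + 3) - c * σ (j + 2)) +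
      (σ 4 - 2 * c * σ 3 + c ^ 2 * σ 2) := by
  refine ge_of_tendsto' ((((h.pow (2 * j + 1)).const_mul (l ^ 2)).add
    (((h.pow (j + 2)).sub ((h.pow (j + 1)).const_mul c)).const_mul (2 * l))).add
    (((h.pow 3).sub ((h.pow 2).const_mul (2 * c))).add ((h.pow 1).const_mul (c ^ 2))))
    fun n => ?_
  have : ∀ V : Multiset ℝ, 0 ≤ l ^ 2 * powSum V (2 * j + 1 + 1) +
      2 * l * (powSum V (j + 2 + 1) - c * powSum V (j + 1 + 1)) +
      (powSum V 4 - 2 * c * powSum V 3 + c ^ 2 * powSum V 2) := by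
    intro V
    induction V using Multiset.induction with
    | empty => simp [powSum]
    | cons u V ih =>
      simp only [powSum_cons]
      have h2 : 0 ≤ (l * u ^ (j + 1) + u * (u - c)) ^ 2 := sq_nonneg _
      have h3 : (l * u ^ (j + 1) + u * (u - c)) ^ 2 = l ^ 2 * u ^ (2 * j + 1 + 1) +
          2 * l * (u ^ (j + 2 + 1) - c * u ^ (j + 1 + 1)) +
          (u ^ 4 - 2 * c * u ^ 3 + c ^ 2 * u ^ 2) := by ring
      linarith
  exact this _

/-- If all nonzero numbers `u` coincide in the limit, then the power sums are geometric. -/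
theorem powSum_geometric (h : IsPosProdLimit U f σ) {c : ℝ}
    (hc : σ 4 - 2 * c * σ 3 + c ^ 2 * σ 2 = 0) (j : ℕ) : σ (j + 3) = c * σ (j + 2) := by
  have hA := h.pow_nonneg (2 * j + 1)
  have hq := fun l => h.quadratic_nonneg c l j
  simp only [hc, add_zero] at hq
  set A := σ (2 * j + 2)
  set B := σ (j + 3) - c * σ (j + 2) with hB
  -- The minimizer would be `-B / A`; adding `1` covers the case `A = 0`.
  have hl := hq (-B / (A + 1))
  have hA1 : 0 < A + 1 := by
    have : 0 ≤ A := hA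
    linarith
  have : (-B / (A + 1)) ^ 2 * A + 2 * (-B / (A + 1)) * B =
      -(B ^ 2 * (A + 2)) / (A + 1) ^ 2 := by
    field_simp
    ring
  rw [this, neg_div, neg_nonneg] at hl
  have hB0 : B ^ 2 * (A + 2) ≤ 0 := by
    by_contra! hpos
    exact absurd hl (not_le.mpr (by positivity))
  have : B = 0 := by
    by_contra hne
    have h1 : 0 < B ^ 2 := by positivity
    nlinarith
  linarith

/-- The logarithmic derivative is now `-(σ 1 + σ 2 X / (1 - c X))`; clearing the denominator gives
`(1 - c X) f' = -(σ 1 (1 - c X) + σ 2 X) f`, read off at the coefficient of `X ^ (k + 2)`. The first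
power sum stays separate because many small `u` may contribute an exponential factor. -/
theorem recursion_of_geometric (h : IsPosProdLimit U f σ) {c : ℝ}
    (hg : ∀ j, σ (j + 3) = c * σ (j + 2)) (k : ℕ) :
    (k + 3) * f (k + 3) + σ 1 * f (k + 2) + σ 2 * f (k + 1) - c * (k + 2) * f (k + 2) -
      c * σ 1 * f (k + 1) = 0 := by
  have h1 := h.newton (k + 1)
  have h2 := h.newton (k + 2)
  rw [Finset.Nat.sum_antidiagonal_succ'] at h1 h2
  rw [Finset.Nat.sum_antidiagonal_succ'] at h2
  simp only [hg, zero_add] at h1 h2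
  have h3 : ∑ p ∈ Finset.HasAntidiagonal.antidiagonal k, f p.1 * (c * σ (p.2 + 2)) =
      c * ∑ p ∈ Finset.HasAntidiagonal.antidiagonal k, f p.1 * σ (p.2 + 2) := by
    rw [Finset.mul_sum]
    exact Finset.sum_congr rfl fun p _ => by ring
  have h4 : ∑ p ∈ Finset.HasAntidiagonal.antidiagonal k, f p.1 * σ (p.2 + 1 + 1) =
      ∑ p ∈ Finset.HasAntidiagonal.antidiagonal k, f p.1 * σ (p.2 + 2) := rfl
  rw [h4] at h1
  rw [h3] at h2
  push_cast at h1 h2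
  norm_num at h1 h2
  linear_combination h2 - c * h1

/-- Coefficients that decay like `1 / (k!)²` exclude that the nonzero numbers `u` coincide in
the limit. -/
theorem quadratic_ne_zero (h : IsPosProdLimit U f σ) (hpos : ∀ k, 0 < (-1) ^ k * f k) {C : ℝ}
    (hC : ∀ k : ℕ, (k + 1) ^ 2 * ((-1) ^ (k + 1) * f (k + 1)) ≤ C * ((-1) ^ k * f k)) (c : ℝ) :
    σ 4 - 2 * c * σ 3 + c ^ 2 * σ 2 ≠ 0 := by
  intro hc
  have hrec := h.recursion_of_geometric (h.powSum_geometric hc)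
  set e : ℕ → ℝ := fun k => (-1) ^ k * f k with he
  set r : ℕ → ℝ := fun k => e (k + 1) / e k with hr
  have hrpos : ∀ k, 0 < r k := fun k => div_pos (hpos _) (hpos _)
  have hrb : ∀ k : ℕ, (k + 1) * r k ≤ C * (1 / (k + 1)) := by
    intro k
    have h0 : 0 < e k := hpos k
    have h1 := hC k
    simp only [hr]
    rw [mul_one_div, le_div_iff₀ (by positivity), mul_div_assoc', div_mul_eq_mul_div,
      div_le_iff₀ h0]
    linarith
  have hlim : Tendsto (fun k : ℕ => (k + 1) * r k) atTop (𝓝 0) := by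
    refine squeeze_zero (fun k => mul_nonneg (by positivity) (hrpos k).le) hrb ?_
    simpa using tendsto_one_div_add_atTop_nhds_zero_nat.const_mul C
  have hlim0 : Tendsto r atTop (𝓝 0) := by
    refine squeeze_zero (fun k => (hrpos k).le) (fun k => ?_) hlim
    have h1 : (0 : ℝ) ≤ k := k.cast_nonneg
    nlinarith [hrpos k]
  have hlim1 := hlim.comp (tendsto_add_atTop_nat 1)
  have hlim2 := hlim.comp (tendsto_add_atTop_nat 2)
  have hlim01 := hlim0.comp (tendsto_add_atTop_nat 1)
  have hrel : ∀ k : ℕ, ((k + 3) * r (k + 2)) * r (k + 1) + c * ((k + 2) * r (k + 1)) -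
      σ 1 * r (k + 1) = c * σ 1 - σ 2 := by
    intro k
    have h1 : e (k + 1) ≠ 0 := (hpos _).ne'
    have h2 : e (k + 2) ≠ 0 := (hpos _).ne'
    have h3 : (k + 3) * e (k + 3) - σ 1 * e (k + 2) + σ 2 * e (k + 1) + c * (k + 2) * e (k + 2) -
        c * σ 1 * e (k + 1) = 0 := by
      simp only [he, pow_succ]
      linear_combination (-(-1) ^ k) * hrec k
    have h4 : r (k + 1) = e (k + 2) / e (k + 1) := rfl
    have h5 : r (k + 2) = e (k + 3) / e (k + 2) := rfl
    rw [h4, h5]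
    field_simp
    linear_combination h3
  -- Every term on the left of `hrel` tends to `0`, while the right side is constant.
  have hd : c * σ 1 - σ 2 = 0 := by
    have : Tendsto (fun _ : ℕ => c * σ 1 - σ 2) atTop (𝓝 (0 * 0 + c * 0 - σ 1 * 0)) := by
      refine Tendsto.congr hrel (((Tendsto.mul ?_ hlim01).add (Tendsto.const_mul c ?_)).sub
        (hlim01.const_mul (σ 1)))
      · refine hlim2.congr fun k => ?_
        simp only [Function.comp]
        push_cast
        ring
      · refine hlim1.congr fun k => ?_
        simp only [Function.comp]
        push_cast
        ring
    simpa using tendsto_nhds_unique tendsto_const_nhds this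
  -- With zero on the right, `hrel` can be divided by `r (k + 1)`. The left side here tends to `0`,
  -- so `c = 0`, then `σ 1 = 0`, contradicting `0 < r 2`.
  have hlin : ∀ k : ℕ, (k + 3) * r (k + 2) = σ 1 - c * (k + 2) := by
    intro k
    have h1 := hrel k
    rw [hd] at h1
    have h2 := (hrpos (k + 1)).ne'
    have h3 : ((k + 3) * r (k + 2) - (σ 1 - c * (k + 2))) * r (k + 1) = 0 := by
      linear_combination h1
    linarith [(mul_eq_zero.mp h3).resolve_right h2]
  have hlim3 : Tendsto (fun k : ℕ => σ 1 - c * ((k : ℝ) + 2)) atTop (𝓝 0) := by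
    refine hlim2.congr fun k => ?_
    rw [← hlin]
    simp only [Function.comp]
    push_cast
    ring
  have hc0 : c = 0 := by
    have h1 := hlim3.sub (hlim3.comp (tendsto_add_atTop_nat 1))
    have h2 : Tendsto (fun _ : ℕ => c) atTop (𝓝 (0 - 0)) := by
      refine h1.congr fun k => ?_
      simp only [Function.comp]
      push_cast
      ring
    simpa using tendsto_nhds_unique tendsto_const_nhds h2
  have h0 := hlin 0
  rw [hc0] at hlim3 h0
  have h1 : σ 1 = 0 := by
    simpa using hlim3
  have := hrpos 2
  rw [h1] at h0
  norm_num at h0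
  linarith

/-- The smallest zero and the Euler–Rayleigh inequalities. -/
theorem exists_first_zero (h : IsPosProdLimit U f σ) (hpos : ∀ k, 0 < (-1) ^ k * f k) {C : ℝ}
    (hC : ∀ k : ℕ, (k + 1) ^ 2 * ((-1) ^ (k + 1) * f (k + 1)) ≤ C * ((-1) ^ k * f k)) :
    ∃ y, 0 < y ∧ realPowerSum f y = 0 ∧ (∀ t ∈ Set.Ico 0 y, 0 < realPowerSum f t) ∧
      0 < σ 1 ∧ 0 < σ 2 ∧ 0 < σ 3 ∧
      1 < σ 1 * y ∧ 1 < σ 2 * y ^ 2 ∧ y * σ 2 < σ 1 ∧ y * σ 3 < σ 2 := by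
  have hq := h.quadratic_ne_zero hpos hC
  have hcont := continuous_realPowerSum (fun r hr => h.summable (r := r) hr)
  -- Without a zero, `mul_pow_succ_le` holds for arbitrarily large `r`, so all power sums from the
  -- second on vanish, which `quadratic_ne_zero` with `c = 0` forbids.
  have hex : ∃ t, 0 ≤ t ∧ realPowerSum f t ≤ 0 := by
    by_contra! hno
    have hz : ∀ k, σ (k + 2) = 0 := by
      intro k
      by_contra hne
      have hp : 0 < σ (k + 2) := lt_of_le_of_ne (h.pow_nonneg (k + 1)) (Ne.symm hne)
      have h0 := h.pow_nonneg k
      have := h.mul_pow_succ_le (r := (σ (k + 1) + 1) / σ (k + 2)) (by positivity)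
        (fun t ht => hno t ht.1) k
      rw [div_mul_cancel₀ _ hne] at this
      linarith
    apply hq 0
    simp [hz 2, hz 0]
  set S : Set ℝ := {t | 0 ≤ t ∧ realPowerSum f t ≤ 0} with hS
  have hSc : IsClosed S :=
    isClosed_Ici.inter (isClosed_Iic.preimage hcont)
  have hSb : BddBelow S := ⟨0, fun t ht => ht.1⟩
  have hyS : sInf S ∈ S := hSc.csInf_mem hex hSb
  set y := sInf S
  have hlt : ∀ t ∈ Set.Ico 0 y, 0 < realPowerSum f t := by
    intro t ht
    by_contra! hle
    exact absurd (csInf_le hSb ⟨ht.1, hle⟩) (not_le.mpr ht.2)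
  have hy0 : 0 < y := by
    refine lt_of_le_of_ne hyS.1 fun h0 => ?_
    have := hyS.2
    rw [← h0, h.realPowerSum_zero] at this
    linarith
  have hyz : realPowerSum f y = 0 := by
    refine le_antisymm hyS.2 ?_
    refine ge_of_tendsto ((hcont.tendsto y).mono_left
      (nhdsWithin_le_nhds : 𝓝[<] y ≤ 𝓝 y)) ?_
    filter_upwards [Ioo_mem_nhdsLT hy0] with t ht using (hlt t ⟨ht.1.le, ht.2⟩).le
  have hle : ∀ k, y * σ (k + 2) ≤ σ (k + 1) := by
    intro k
    by_contra! hgt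
    have hp : 0 < σ (k + 2) := by
      have := h.pow_nonneg k
      by_contra! hn
      nlinarith
    obtain ⟨r, hr1, hr2⟩ := exists_between ((div_lt_iff₀ hp).mpr hgt)
    have hr0 : 0 ≤ r := le_trans (div_nonneg (h.pow_nonneg k) hp.le) hr1.le
    have := h.mul_pow_succ_le hr0 (fun t ht => hlt t ⟨ht.1, lt_of_le_of_lt ht.2 hr2⟩) k
    exact absurd ((div_lt_iff₀ hp).mp hr1) (not_lt.mpr this)
  have hge : ∀ k, 1 ≤ σ (k + 1) * y ^ (k + 1) := by
    intro k
    by_contra! hlt1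
    exact (h.realPowerSum_pos hy0.le hlt1).ne' hyz
  have hσ : ∀ k, 0 < σ (k + 1) := by
    intro k
    have h1 : 0 < σ (k + 1) * y ^ (k + 1) := lt_of_lt_of_le one_pos (hge k)
    exact pos_of_mul_pos_left h1 (by positivity)
  -- Equality would turn the limit of `∑ u² (u - 1 / y)²` into `(y * σ 4 - σ 3) / y ≤ 0`, so it
  -- would vanish. The other strict inequalities descend from this one.
  have hD : y * σ 3 < σ 2 := by
    refine lt_of_le_of_ne (hle 1) fun heq => hq (1 / y) ?_
    have h1 := h.quadratic_nonneg (1 / y) 0 0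
    have h2 : y * σ 4 ≤ σ 3 := hle 2
    have h3 : σ 4 - 2 * (1 / y) * σ 3 + (1 / y) ^ 2 * σ 2 = (y * σ 4 - σ 3) / y := by
      rw [← heq]
      field_simp
      ring
    norm_num at h1
    refine le_antisymm ?_ (by simpa using h1)
    rw [h3]
    exact div_nonpos_of_nonpos_of_nonneg (by linarith) hy0.le
  have hCC : y * σ 2 < σ 1 := by
    refine lt_of_le_of_ne (hle 0) fun heq => absurd hD (not_lt.mpr ?_)
    have h1 := h.quadratic_one_nonneg (1 / y)
    have h3 : σ 3 - 2 * (1 / y) * σ 2 + (1 / y) ^ 2 * σ 1 = (y * σ 3 - σ 2) / y := by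
      rw [← heq]
      field_simp
      ring
    rw [h3] at h1
    by_contra! hn
    exact absurd h1 (not_le.mpr (div_neg_of_neg_of_pos (by linarith) hy0))
  have hB : 1 < σ 2 * y ^ 2 := by
    have h4 := hge 3
    have h5 : y * σ 4 ≤ σ 3 := hle 2
    norm_num at h4
    have h6 : σ 4 * y ^ 4 ≤ σ 3 * y ^ 3 := by
      have : σ 4 * y ^ 4 = y * σ 4 * y ^ 3 := by ring
      rw [this]
      gcongr
    have h7 : σ 3 * y ^ 3 < σ 2 * y ^ 2 := by
      have : σ 3 * y ^ 3 = y * σ 3 * y ^ 2 := by ring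
      rw [this]
      gcongr
    linarith
  refine ⟨y, hy0, hyz, hlt, hσ 0, hσ 1, hσ 2, ?_, hB, hCC, hD⟩
  nlinarith

end IsPosProdLimit

/-! ### Stability of the class under first-order operators. -/

namespace IsPosProdLimit

variable {U : ℕ → Multiset ℝ} {f σ : ℕ → ℝ}

/-- The class of limits of `∏ (1 - u X)` is stable under `1 + s X d/dX - b X`. -/
theorem exists_operator (h : IsPosProdLimit U f σ) {s b : ℝ} (hs : 0 ≤ s) (hb : 0 ≤ b)
    {g : ℕ → ℝ} (hg0 : g 0 = 1) (hg : ∀ k : ℕ, g (k + 1) = (1 + s * (k + 1)) * f (k + 1) - b * f k) :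
    ∃ V τ, IsPosProdLimit V g τ ∧ ∀ n, posProd (V n) = posProd (U n) +
      Polynomial.C s * (Polynomial.X * Polynomial.derivative (posProd (U n))) -
        Polynomial.C b * (Polynomial.X * posProd (U n)) := by
  choose V hV hVe using fun n => exists_posProd_eq_add_derivative (h.nonneg n) hs hb
  obtain ⟨τ, hτ⟩ := exists_isPosProdLimit (U := V) (f := g) hV (by
    intro k
    cases k with
    | zero => simp [posProd_coeff_zero, hg0]
    | succ k =>
      rw [hg]
      refine (((h.coeff (k + 1)).const_mul (1 + s * (k + 1))).sub
        ((h.coeff k).const_mul b)).congr fun n => ?_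
      rw [← hVe, Polynomial.coeff_sub, Polynomial.coeff_add, Polynomial.coeff_C_mul,
        Polynomial.coeff_C_mul, Polynomial.coeff_X_mul, Polynomial.coeff_X_mul,
        Polynomial.coeff_derivative]
      ring)
  exact ⟨V, τ, hτ, fun n => (hVe n).symm⟩

theorem exists_euler (h : IsPosProdLimit U f σ) {s : ℝ} (hs : 0 ≤ s) :
    ∃ V τ, IsPosProdLimit V (fun k => (1 + s * k) * f k) τ ∧ ∀ n, posProd (V n) = posProd (U n) +
      Polynomial.C s * (Polynomial.X * Polynomial.derivative (posProd (U n))) := by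
  obtain ⟨V, τ, h1, h2⟩ := h.exists_operator (g := fun k => (1 + s * k) * f k) hs le_rfl
    (by simp [h.coeff_zero]) (fun k => by push_cast; ring)
  exact ⟨V, τ, h1, fun n => by simpa using h2 n⟩

end IsPosProdLimit

/-! ### Logarithmic derivatives and the Euler transform `f + s z f'`. -/

theorem posProd_map_mul_coeff (m : ℝ) (U : Multiset ℝ) (k : ℕ) :
    (posProd (U.map (m * ·))).coeff k = m ^ k * (posProd U).coeff k := by
  induction U using Multiset.induction generalizing k with
  | empty =>
    rw [Multiset.map_zero, posProd_zero, Polynomial.coeff_one]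
    split_ifs with h <;> simp [h]
  | cons u U ih =>
    rw [Multiset.map_cons, posProd_cons, posProd_cons]
    simp only [sub_mul, one_mul, mul_assoc, Polynomial.coeff_sub, Polynomial.coeff_C_mul, ih]
    cases k with
    | zero => simp
    | succ k =>
      rw [Polynomial.coeff_X_mul, Polynomial.coeff_X_mul, ih]
      ring

/-- The field is general because the formula is compared at `z` in `ℂ` and at `‖z‖` in `ℝ`. -/
theorem posProd_aeval_mul_derivative {K : Type*} [Field K] [Algebra ℝ K] (U : Multiset ℝ) {x : K}
    (hx : ∀ u ∈ U, 1 - algebraMap ℝ K u * x ≠ 0) :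
    x * Polynomial.aeval x (Polynomial.derivative (posProd U)) =
      -(Polynomial.aeval x (posProd U)) *
        (U.map fun u => algebraMap ℝ K u * x / (1 - algebraMap ℝ K u * x)).sum := by
  induction U using Multiset.induction with
  | empty => simp [posProd_zero]
  | cons u U ih =>
    have h1 := ih fun v hv => hx v (Multiset.mem_cons_of_mem hv)
    have h2 := hx u (Multiset.mem_cons_self _ _)
    rw [posProd_cons, Multiset.map_cons, Multiset.sum_cons]
    simp only [Polynomial.derivative_mul, map_add, map_mul, map_sub, map_one,
      Polynomial.derivative_one, Polynomial.derivative_C, Polynomial.derivative_X,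
      Polynomial.aeval_C, Polynomial.aeval_X, zero_mul, mul_one, zero_add, zero_sub, map_neg]
    set P := Polynomial.aeval x (posProd U)
    set W := (U.map fun u => algebraMap ℝ K u * x / (1 - algebraMap ℝ K u * x)).sum
    have h3 : algebraMap ℝ K u * x / (1 - algebraMap ℝ K u * x) *
        (1 - algebraMap ℝ K u * x) = algebraMap ℝ K u * x := div_mul_cancel₀ _ h2
    linear_combination (1 - algebraMap ℝ K u * x) * h1 + P * h3

theorem posProd_eval_pos {U : Multiset ℝ} {r : ℝ} (h : ∀ u ∈ U, u * r < 1) :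
    0 < (posProd U).eval r := by
  rw [posProd_eval]
  refine Multiset.prod_pos fun x hx => ?_
  obtain ⟨u, hu, rfl⟩ := Multiset.mem_map.mp hx
  linarith [h u hu]

/-- Termwise `x / (1 - x) ≥ x + x²` with `x = u * r`. The quadratic term is kept to obtain a strict
inequality after the limit. -/
theorem posProd_euler_le {U : Multiset ℝ} (hU : ∀ u ∈ U, 0 ≤ u) {s r : ℝ} (hs : 0 ≤ s)
    (hr : 0 ≤ r) (h : ∀ u ∈ U, u * r < 1) :
    (posProd U + Polynomial.C s * (Polynomial.X * Polynomial.derivative (posProd U))).eval r ≤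
      (posProd U).eval r * (1 - s * (r * powSum U 1 + r ^ 2 * powSum U 2)) := by
  have h1 := posProd_aeval_mul_derivative (K := ℝ) U (x := r) (fun u hu => by
    have := h u hu
    simp only [Algebra.algebraMap_self, RingHom.id_apply]
    linarith)
  simp only [Polynomial.coe_aeval_eq_eval, Algebra.algebraMap_self, RingHom.id_apply] at h1
  simp only [Polynomial.eval_add, Polynomial.eval_mul, Polynomial.eval_C, Polynomial.eval_X]
  have h2 : ∀ V : Multiset ℝ, (∀ u ∈ V, 0 ≤ u ∧ u * r < 1) →
      r * powSum V 1 + r ^ 2 * powSum V 2 ≤ (V.map fun u => u * r / (1 - u * r)).sum := by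
    intro V
    induction V using Multiset.induction with
    | empty => simp [powSum]
    | cons u V ih =>
      intro hV
      have h3 := ih fun v hv => hV v (Multiset.mem_cons_of_mem hv)
      obtain ⟨hu, hur⟩ := hV u (Multiset.mem_cons_self _ _)
      rw [powSum_cons, powSum_cons, Multiset.map_cons, Multiset.sum_cons]
      have h4 : u * r + (u * r) ^ 2 ≤ u * r / (1 - u * r) := by
        rw [le_div_iff₀ (by linarith)]
        have : 0 ≤ u * r := by positivity
        nlinarith [_root_.pow_nonneg this 3]
      linarith
  have h3 := h2 U fun u hu => ⟨hU u hu, h u hu⟩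
  have h4 := posProd_eval_pos h
  rw [h1]
  have h5 := mul_le_mul_of_nonneg_left (mul_le_mul_of_nonneg_left h3 hs) h4.le
  linarith

theorem posProd_norm_le {U : Multiset ℝ} (hU : ∀ u ∈ U, 0 ≤ u) {z : ℂ}
    (h : ∀ u ∈ U, u * ‖z‖ < 1) : (posProd U).eval ‖z‖ ≤ ‖Polynomial.aeval z (posProd U)‖ := by
  rw [posProd_eval, posProd_aeval]
  induction U using Multiset.induction with
  | empty => simp
  | cons u U ih =>
    have h1 := ih (fun v hv => hU v (Multiset.mem_cons_of_mem hv))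
      (fun v hv => h v (Multiset.mem_cons_of_mem hv))
    have hu := hU u (Multiset.mem_cons_self _ _)
    have hur := h u (Multiset.mem_cons_self _ _)
    have h2 : 1 - u * ‖z‖ ≤ ‖1 - (u : ℂ) * z‖ := by
      have := norm_sub_norm_le (1 : ℂ) ((u : ℂ) * z)
      rwa [norm_one, norm_mul, Complex.norm_real, Real.norm_of_nonneg hu] at this
    simp only [Multiset.map_cons, Multiset.prod_cons, norm_mul]
    refine mul_le_mul h2 h1 ?_ (norm_nonneg _)
    refine Multiset.prod_nonneg fun x hx => ?_
    obtain ⟨v, hv, rfl⟩ := Multiset.mem_map.mp hx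
    linarith [h v (Multiset.mem_cons_of_mem hv)]

/-- Both quotients are `1 - s ∑ w / (1 - w)` with `w = u z` or `w = u ‖z‖`, and `Re (w / (1 - w)) ≤
|w| / (1 - |w|)` for `|w| < 1`. -/
theorem posProd_euler_re_ge {U : Multiset ℝ} (hU : ∀ u ∈ U, 0 ≤ u) {s : ℝ} (hs : 0 ≤ s) {z : ℂ}
    (h : ∀ u ∈ U, u * ‖z‖ < 1) :
    (posProd U + Polynomial.C s * (Polynomial.X * Polynomial.derivative (posProd U))).eval ‖z‖ /
        (posProd U).eval ‖z‖ ≤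
      (Polynomial.aeval z (posProd U +
        Polynomial.C s * (Polynomial.X * Polynomial.derivative (posProd U))) /
          Polynomial.aeval z (posProd U)).re := by
  have hne : ∀ u ∈ U, 1 - u * ‖z‖ ≤ ‖1 - (u : ℂ) * z‖ := by
    intro u hu
    have := norm_sub_norm_le (1 : ℂ) ((u : ℂ) * z)
    rwa [norm_one, norm_mul, Complex.norm_real, Real.norm_of_nonneg (hU u hu)] at this
  have h1 := posProd_aeval_mul_derivative (K := ℝ) U (x := ‖z‖) (fun u hu => by
    have := h u hu
    simp only [Algebra.algebraMap_self, RingHom.id_apply]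
    linarith)
  have h2 := posProd_aeval_mul_derivative (K := ℂ) U (x := z) (fun u hu h0 => by
    have h3 := hne u hu
    rw [Complex.coe_algebraMap] at h0
    rw [h0, norm_zero] at h3
    linarith [h u hu])
  simp only [Polynomial.coe_aeval_eq_eval, Algebra.algebraMap_self, RingHom.id_apply] at h1
  simp only [Complex.coe_algebraMap] at h2
  have h4 := posProd_eval_pos h
  have h5 : Polynomial.aeval z (posProd U) ≠ 0 :=
    norm_pos_iff.mp (lt_of_lt_of_le h4 (posProd_norm_le hU h))
  simp only [Polynomial.eval_add, Polynomial.eval_mul, Polynomial.eval_C, Polynomial.eval_X,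
    map_add, map_mul, Polynomial.aeval_C, Polynomial.aeval_X, Complex.coe_algebraMap]
  rw [h1, h2, neg_mul, neg_mul]
  have e1 : ∀ {K : Type} [Field K] (p s w : K), p ≠ 0 → (p + s * -(p * w)) / p = 1 - s * w := by
    intro K _ p s w hp
    field_simp
    ring
  rw [e1 _ _ _ h4.ne', e1 _ _ _ h5, Complex.sub_re, Complex.one_re, Complex.re_ofReal_mul]
  have h6 : ∀ V : Multiset ℝ, (∀ u ∈ V, u ∈ U) →
      (V.map fun u : ℝ => (u : ℂ) * z / (1 - (u : ℂ) * z)).sum.re ≤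
        (V.map fun u => u * ‖z‖ / (1 - u * ‖z‖)).sum := by
    intro V
    induction V using Multiset.induction with
    | empty => simp
    | cons u V ih =>
      intro hV
      have h7 := ih fun v hv => hV v (Multiset.mem_cons_of_mem hv)
      have hu := hV u (Multiset.mem_cons_self _ _)
      simp only [Multiset.map_cons, Multiset.sum_cons, Complex.add_re]
      refine add_le_add ((Complex.re_le_norm _).trans ?_) h7
      rw [norm_div, norm_mul, Complex.norm_real, Real.norm_of_nonneg (hU u hu)]
      have h8 : 0 < 1 - u * ‖z‖ := by linarith [h u hu]
      have h9 := hne u hu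
      have h10 := hU u hu
      gcongr
  have := h6 U fun u hu => hu
  gcongr

namespace IsPosProdLimit

variable {U : ℕ → Multiset ℝ} {f σ : ℕ → ℝ}

theorem euler_le (h : IsPosProdLimit U f σ) {s r : ℝ} (hs : 0 ≤ s) (hr : 0 ≤ r)
    (hT : ∀ t ∈ Set.Icc 0 r, 0 < realPowerSum f t) :
    realPowerSum (fun k => (1 + s * k) * f k) r ≤
      realPowerSum f r * (1 - s * (r * σ 1 + r ^ 2 * σ 2)) := by
  obtain ⟨V, τ, hV, hVe⟩ := h.exists_euler hs
  refine le_of_tendsto_of_tendsto (hV.tendsto_eval r) ((h.tendsto_eval r).mul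
    ((((h.pow 0).const_mul r).add ((h.pow 1).const_mul (r ^ 2))).const_mul s |>.const_sub 1)) ?_
  filter_upwards [h.eventually_mul_lt_one hr hT] with n hn
  rw [hVe]
  exact posProd_euler_le (h.nonneg n) hs hr hn

/-- The function is positive up to the first zero `y` of its Euler transform, and `s σ₁ y < 1`. -/
theorem first_zero_euler (h : IsPosProdLimit U f σ) (hpos : ∀ k, 0 < (-1) ^ k * f k) {C : ℝ}
    (hC : ∀ k : ℕ, (k + 1) ^ 2 * ((-1) ^ (k + 1) * f (k + 1)) ≤ C * ((-1) ^ k * f k))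
    {s y : ℝ} (hs : 0 < s) (hy : 0 < y)
    (hF : ∀ t ∈ Set.Ico 0 y, 0 < realPowerSum (fun k => (1 + s * k) * f k) t) :
    (∀ t ∈ Set.Ico 0 y, 0 < realPowerSum f t) ∧ s * σ 1 * y < 1 := by
  obtain ⟨x, hx, hx0, hxpos, h1, h2, -⟩ := h.exists_first_zero hpos hC
  have hcont := continuous_realPowerSum (fun r hr => h.summable (r := r) hr)
  obtain ⟨V, τ, hV, -⟩ := h.exists_euler hs.le
  have hcontF := continuous_realPowerSum (fun r hr => hV.summable (r := r) hr)
  have hle : ∀ t ∈ Set.Ico 0 x, realPowerSum (fun k => (1 + s * k) * f k) t ≤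
      realPowerSum f t * (1 - s * (t * σ 1 + t ^ 2 * σ 2)) := fun t ht =>
    h.euler_le hs.le ht.1 fun t' ht' => hxpos t' ⟨ht'.1, lt_of_le_of_lt ht'.2 ht.2⟩
  -- At the first zero `x` of `f` the upper bound for the Euler transform is zero, so positivity of
  -- the transform on `[0, y)` forces `y ≤ x`.
  have hFx : realPowerSum (fun k => (1 + s * k) * f k) x ≤ 0 := by
    have hc2 : Continuous fun t => realPowerSum f t * (1 - s * (t * σ 1 + t ^ 2 * σ 2)) := by
      fun_prop
    have := le_of_tendsto_of_tendsto
      ((hcontF.tendsto x).mono_left (nhdsWithin_le_nhds : 𝓝[<] x ≤ 𝓝 x))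
      ((hc2.tendsto x).mono_left (nhdsWithin_le_nhds : 𝓝[<] x ≤ 𝓝 x)) (by
        filter_upwards [Ioo_mem_nhdsLT hx] with t ht using hle t ⟨ht.1.le, ht.2⟩)
    simpa [hx0] using this
  have hyx : y ≤ x := by
    by_contra! hlt
    exact absurd (hF x ⟨hx.le, hlt⟩) (not_lt.mpr hFx)
  have hT : ∀ t ∈ Set.Ico 0 y, 0 < realPowerSum f t :=
    fun t ht => hxpos t ⟨ht.1, lt_of_lt_of_le ht.2 hyx⟩
  refine ⟨hT, ?_⟩
  -- Before `y` the transform is positive, hence so is the factor bounding it. Dropping the positive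
  -- term with `σ 2` afterwards makes the inequality strict.
  have hlim : s * (y * σ 1 + y ^ 2 * σ 2) ≤ 1 := by
    have hc2 : Continuous fun t : ℝ => s * (t * σ 1 + t ^ 2 * σ 2) := by fun_prop
    refine le_of_tendsto ((hc2.tendsto y).mono_left (nhdsWithin_le_nhds : 𝓝[<] y ≤ 𝓝 y)) ?_
    filter_upwards [Ioo_mem_nhdsLT hy] with t ht
    have ht' : t ∈ Set.Ico 0 y := ⟨ht.1.le, ht.2⟩
    have h3 := hle t ⟨ht.1.le, lt_of_lt_of_le ht.2 hyx⟩
    have h4 := pos_of_mul_pos_right (lt_of_lt_of_le (hF t ht') h3) (hT t ht').le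
    linarith
  have : 0 < s * (y ^ 2 * σ 2) := by positivity
  linarith

/-- Starlikeness of the limit up to the first zero of its Euler transform. -/
theorem euler_div_re_pos (h : IsPosProdLimit U f σ) {s : ℝ} (hs : 0 ≤ s) {z : ℂ}
    (hT : ∀ t ∈ Set.Icc 0 ‖z‖, 0 < realPowerSum f t)
    (hF : 0 < realPowerSum (fun k => (1 + s * k) * f k) ‖z‖) :
    0 < (powerSum (fun k => (1 + s * k) * f k) z / powerSum f z).re := by
  obtain ⟨V, τ, hV, hVe⟩ := h.exists_euler hs
  have hev := h.eventually_mul_lt_one (norm_nonneg z) hT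
  have hTz : 0 < realPowerSum f ‖z‖ := hT _ ⟨norm_nonneg z, le_rfl⟩
  have hne : powerSum f z ≠ 0 := by
    rw [← norm_pos_iff]
    refine lt_of_lt_of_le hTz
      (le_of_tendsto_of_tendsto (h.tendsto_eval ‖z‖) (h.tendsto_aeval z).norm ?_)
    filter_upwards [hev] with n hn using posProd_norm_le (h.nonneg n) hn
  refine lt_of_lt_of_le (div_pos hF hTz) (le_of_tendsto_of_tendsto
    ((hV.tendsto_eval ‖z‖).div (h.tendsto_eval ‖z‖) hTz.ne')
    ((Complex.continuous_re.tendsto _).comp ((hV.tendsto_aeval z).div (h.tendsto_aeval z) hne)) ?_)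
  filter_upwards [hev] with n hn
  simp only [Function.comp, Pi.div_apply, hVe]
  exact posProd_euler_re_ge (h.nonneg n) hs hn

end IsPosProdLimit

/-! ### Laguerre polynomials and the Bessel series. -/

/-- The rising factorial `(ν + 1) ⋯ (ν + k)`. -/
noncomputable def risingProd (ν : ℝ) (k : ℕ) : ℝ := ∏ j ∈ Finset.range k, (ν + 1 + j)

theorem risingProd_succ (ν : ℝ) (k : ℕ) :
    risingProd ν (k + 1) = risingProd ν k * (ν + 1 + k) := Finset.prod_range_succ _ _

theorem risingProd_succ_left (ν : ℝ) (k : ℕ) :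
    risingProd ν (k + 1) = (ν + 1) * risingProd (ν + 1) k := by
  rw [risingProd, Finset.prod_range_succ', mul_comm, risingProd]
  congr 1
  · simp
  · exact Finset.prod_congr rfl fun j _ => by push_cast; ring

theorem risingProd_pos {ν : ℝ} (hν : 0 < ν) (k : ℕ) : 0 < risingProd ν k :=
  Finset.prod_pos fun j _ => by positivity

theorem gamma_add_natCast {ν : ℝ} (hν : 0 < ν) (k : ℕ) :
    Real.Gamma (k + ν + 1) = Real.Gamma (ν + 1) * risingProd ν k := by
  induction k with
  | zero => simp [risingProd]
  | succ k ih =>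
    have h : ((k + 1 : ℕ) : ℝ) + ν + 1 = (k + ν + 1) + 1 := by push_cast; ring
    rw [h, Real.Gamma_add_one (by positivity), ih, risingProd_succ]
    ring

/-- Laguerre polynomials, normalized by `1` at the origin, have positive roots. -/
theorem exists_laguerre (n : ℕ) : ∀ {ν : ℝ}, 0 < ν → ∃ U : Multiset ℝ, (∀ u ∈ U, 0 ≤ u) ∧
    ∀ k, (posProd U).coeff k = (-1) ^ k * n.choose k / risingProd ν k := by
  induction n with
  | zero =>
    intro ν _
    refine ⟨0, by simp, fun k => ?_⟩
    cases k with
    | zero => simp [posProd_zero, risingProd]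
    | succ k => simp [posProd_zero, Polynomial.coeff_one]
  | succ n ih =>
    intro ν hν
    obtain ⟨U, hU, hc⟩ := ih (ν := ν + 1) (by linarith)
    -- This operator leads from degree `n` and parameter `ν + 1` to degree `n + 1` and parameter
    -- `ν`, by Pascal's rule.
    obtain ⟨V, hV, hVe⟩ := exists_posProd_eq_add_derivative hU (s := 1 / (ν + 1))
      (b := 1 / (ν + 1)) (by positivity) (by positivity)
    refine ⟨V, hV, fun k => ?_⟩
    cases k with
    | zero => simp [posProd_coeff_zero, risingProd]
    | succ k =>
      rw [← hVe, Polynomial.coeff_sub, Polynomial.coeff_add, Polynomial.coeff_C_mul,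
        Polynomial.coeff_C_mul, Polynomial.coeff_X_mul, Polynomial.coeff_X_mul,
        Polynomial.coeff_derivative, hc, hc, risingProd_succ, risingProd_succ_left ν,
        Nat.choose_succ_succ]
      have h1 := (risingProd_pos (show 0 < ν + 1 by linarith) k).ne'
      have h2 : ν + 1 ≠ 0 := by positivity
      have h3 : ν + 1 + 1 + k ≠ 0 := by positivity
      push_cast
      field_simp
      ring

/-- The coefficients of `∑ (-1) ^ k t ^ k / (4 ^ k k! (ν + 1) ⋯ (ν + k))`. -/
noncomputable def besselCoeff (ν : ℝ) (k : ℕ) : ℝ :=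
  (-1) ^ k / (4 ^ k * k.factorial * risingProd ν k)

theorem besselCoeff_succ {ν : ℝ} (hν : 0 < ν) (k : ℕ) :
    4 * (k + 1) * (ν + 1 + k) * besselCoeff ν (k + 1) = -besselCoeff ν k := by
  have h1 := (risingProd_pos hν k).ne'
  have h3 : ν + 1 + k ≠ 0 := by positivity
  have h4 : (k.factorial : ℝ) ≠ 0 := by positivity
  have h5 : (k : ℝ) + 1 ≠ 0 := by positivity
  rw [besselCoeff, besselCoeff, risingProd_succ, Nat.factorial_succ]
  push_cast
  field_simp
  ring

theorem besselCoeff_pos {ν : ℝ} (hν : 0 < ν) (k : ℕ) : 0 < (-1) ^ k * besselCoeff ν k := by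
  have h1 := risingProd_pos hν k
  rw [besselCoeff, ← mul_div_assoc, ← mul_pow]
  norm_num
  positivity

theorem exists_besselCoeff_limit {ν : ℝ} (hν : 0 < ν) :
    ∃ U σ, IsPosProdLimit U (besselCoeff ν) σ := by
  choose U hU hc using fun n => exists_laguerre n hν
  -- Replacing the variable `t` by `t / (4 n)` works because `n.choose k / (4 n) ^ k` tends to `1 /
  -- (4 ^ k k!)`.
  obtain ⟨σ, hσ⟩ := exists_isPosProdLimit (U := fun n => (U n).map (((4 * n : ℝ))⁻¹ * ·))
    (f := besselCoeff ν)
    (by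
      intro n v hv
      obtain ⟨u, hu, rfl⟩ := Multiset.mem_map.mp hv
      exact mul_nonneg (by positivity) (hU n u hu))
    (by
      intro k
      have h1 : Tendsto (fun n : ℕ => (n : ℝ) * (4 * n : ℝ)⁻¹) atTop (𝓝 (1 / 4)) := by
        refine tendsto_const_nhds.congr' ?_
        filter_upwards [eventually_gt_atTop 0] with n hn
        have : (n : ℝ) ≠ 0 := by positivity
        field_simp
      have h2 := ((ProbabilityTheory.tendsto_choose_mul_pow_atTop k h1).const_mul
        ((-1) ^ k / risingProd ν k))
      have h3 := (risingProd_pos hν k).ne'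
      have h4 : besselCoeff ν k = (-1) ^ k / risingProd ν k * ((1 / 4) ^ k / k.factorial) := by
        rw [besselCoeff, one_div, inv_pow]
        field_simp
      rw [h4]
      refine h2.congr fun n => ?_
      rw [posProd_map_mul_coeff, hc]
      ring)
  exact ⟨_, σ, hσ⟩

/-- Supplies the sign and decay hypotheses of `exists_first_zero`: weights of at most geometric
growth do not spoil the decay of the Bessel coefficients. -/
theorem besselCoeff_weight {ν : ℝ} (hν : 0 < ν) {w : ℕ → ℝ} (hw : ∀ k, 0 < w k) {D : ℝ}
    (hD : ∀ k, w (k + 1) ≤ D * w k) :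
    (∀ k, 0 < (-1) ^ k * (w k * besselCoeff ν k)) ∧
      ∀ k : ℕ, (k + 1) ^ 2 * ((-1) ^ (k + 1) * (w (k + 1) * besselCoeff ν (k + 1))) ≤
        D * ((-1) ^ k * (w k * besselCoeff ν k)) := by
  have he := besselCoeff_pos hν
  refine ⟨fun k => ?_, fun k => ?_⟩
  · rw [mul_left_comm]
    exact mul_pos (hw k) (he k)
  · have h1 := he k
    have h2 := he (k + 1)
    have h3 : ((k : ℝ) + 1) ^ 2 * ((-1) ^ (k + 1) * besselCoeff ν (k + 1)) ≤
        (-1) ^ k * besselCoeff ν k := by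
      have h4 : (-1) ^ k * besselCoeff ν k =
          4 * (k + 1) * (ν + 1 + k) * ((-1) ^ (k + 1) * besselCoeff ν (k + 1)) := by
        rw [pow_succ]
        linear_combination (-1) ^ k * besselCoeff_succ hν k
      rw [h4]
      gcongr
      have : (0 : ℝ) ≤ k := k.cast_nonneg
      nlinarith
    calc ((k : ℝ) + 1) ^ 2 * ((-1) ^ (k + 1) * (w (k + 1) * besselCoeff ν (k + 1)))
        = w (k + 1) * (((k : ℝ) + 1) ^ 2 * ((-1) ^ (k + 1) * besselCoeff ν (k + 1))) := by ring
      _ ≤ (D * w k) * ((-1) ^ k * besselCoeff ν k) := by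
        gcongr
        · exact ((hw _).le.trans (hD k))
        · exact hD k
      _ = _ := by ring

theorem quadratic_weight {A B : ℝ} (hA : 0 ≤ A) (hB : 0 ≤ B) {s : ℝ} (hs : 0 ≤ s) :
    (∀ k : ℕ, 0 < (1 + s * k) * (1 + A * k + B * k ^ 2)) ∧
      ∀ k : ℕ, (1 + s * (k + 1 : ℕ)) * (1 + A * (k + 1 : ℕ) + B * (k + 1 : ℕ) ^ 2) ≤
        (1 + s) * (2 + A + 2 * B) * ((1 + s * k) * (1 + A * k + B * k ^ 2)) := by
  refine ⟨fun k => by positivity, fun k => ?_⟩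
  have hk : (0 : ℝ) ≤ k := k.cast_nonneg
  push_cast
  have h1 : 1 + s * ((k : ℝ) + 1) ≤ (1 + s) * (1 + s * k) := by
    nlinarith [mul_nonneg hs (mul_nonneg hs hk)]
  have h2 : 1 + A * ((k : ℝ) + 1) + B * (k + 1) ^ 2 ≤ (2 + A + 2 * B) * (1 + A * k + B * k ^ 2) := by
    have e1 : 0 ≤ A * k := by positivity
    have e2 : 0 ≤ B * k ^ 2 := by positivity
    have e3 : 0 ≤ (A + 2 * B) * (A * k + B * k ^ 2) := by positivity
    nlinarith [mul_nonneg hB (sq_nonneg ((k : ℝ) - 1))]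
  calc _ ≤ ((1 + s) * (1 + s * k)) * ((2 + A + 2 * B) * (1 + A * k + B * k ^ 2)) := by gcongr
    _ = _ := by ring

/-! ### The weight `Q`. -/

/-- The normalized series of `N_ν` is a limit of polynomials with positive roots. -/
theorem exists_mercer_limit {a b c ν : ℝ} (habc : (c = 0 ∧ a ≠ b) ∨ (0 < c ∧ a < b))
    (hν : 0 < ν) (hroot : ∀ x : ℝ, mercerQ a b c x = 0 → x < ν) :
    mercerQ a b c ν ≠ 0 ∧ ∃ A B : ℝ, 0 ≤ A ∧ 0 ≤ B ∧
      (∀ k : ℕ, mercerQ a b c (2 * k + ν) = mercerQ a b c ν * (1 + A * k + B * k ^ 2)) ∧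
      ∃ U σ, IsPosProdLimit U (fun k => (1 + A * k + B * k ^ 2) * besselCoeff ν k) σ := by
  have hne : mercerQ a b c ν ≠ 0 := fun h => lt_irrefl _ (hroot ν h)
  refine ⟨hne, ?_⟩
  obtain ⟨U, σ, hU⟩ := exists_besselCoeff_limit hν
  -- A real root `x < ν` of `Q` contributes the factor `1 + 2 k / (ν - x)`, which is one Euler
  -- transform.
  have real_case : (∃ s t : ℝ, 0 ≤ s ∧ 0 ≤ t ∧ ∀ k : ℕ, mercerQ a b c (2 * k + ν) =
      mercerQ a b c ν * ((1 + s * k) * (1 + t * k))) → ∃ A B : ℝ, 0 ≤ A ∧ 0 ≤ B ∧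
      (∀ k : ℕ, mercerQ a b c (2 * k + ν) = mercerQ a b c ν * (1 + A * k + B * k ^ 2)) ∧
      ∃ U σ, IsPosProdLimit U (fun k => (1 + A * k + B * k ^ 2) * besselCoeff ν k) σ := by
    rintro ⟨s, t, hs, ht, h⟩
    obtain ⟨V, τ, hV, -⟩ := hU.exists_euler hs
    obtain ⟨W, ω, hW, -⟩ := hV.exists_euler ht
    refine ⟨s + t, s * t, by positivity, by positivity, fun k => ?_, W, ω, ?_⟩
    · rw [h]
      ring
    · convert hW using 2 with k
      ring
  have key : ∀ x k : ℝ, x < ν → 1 + 2 / (ν - x) * k = (2 * k + ν - x) / (ν - x) := by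
    intro x k hx
    have : ν - x ≠ 0 := by linarith
    field_simp
    ring
  rcases habc with ⟨rfl, hab⟩ | ⟨hc, hab⟩
  · apply real_case
    by_cases ha : a = 0
    · subst ha
      refine ⟨2 / ν, 0, by positivity, le_rfl, fun k => ?_⟩
      simp only [mercerQ]
      field_simp
      ring
    · have hx : (a - b) / a < ν := hroot _ (by
        simp only [mercerQ]
        field_simp
        ring)
      refine ⟨2 / (ν - 0), 2 / (ν - (a - b) / a), div_nonneg (by norm_num) (by linarith),
        div_nonneg (by norm_num) (by linarith), fun k => ?_⟩
      rw [key _ _ hν, key _ _ hx]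
      have hf : ∀ x, mercerQ a b 0 x = a * ((x - 0) * (x - (a - b) / a)) := by
        intro x
        simp only [mercerQ]
        field_simp
        ring
      rw [hf, hf]
      have h1 : ν - 0 ≠ 0 := by linarith
      have h2 : ν - (a - b) / a ≠ 0 := by linarith
      generalize (a - b) / a = x at *
      field_simp
  · rcases lt_or_ge a 0 with ha | ha
    · apply real_case
      have ha0 : a ≠ 0 := ha.ne
      have hdisc : 0 < (b - a) ^ 2 - 4 * a * c := by
        nlinarith [sq_nonneg (b - a), mul_pos_of_neg_of_neg ha (neg_lt_zero.mpr hc)]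
      set d := Real.sqrt ((b - a) ^ 2 - 4 * a * c)
      have hd : d ^ 2 = (b - a) ^ 2 - 4 * a * c := Real.sq_sqrt hdisc.le
      have hf : ∀ x, mercerQ a b c x =
          a * ((x - (-(b - a) + d) / (2 * a)) * (x - (-(b - a) - d) / (2 * a))) := by
        intro x
        have : a * ((x - (-(b - a) + d) / (2 * a)) * (x - (-(b - a) - d) / (2 * a))) =
            a * x ^ 2 + (b - a) * x + ((b - a) ^ 2 - d ^ 2) / (4 * a) := by
          field_simp
          ring
        rw [this, hd, mercerQ]
        field_simp
        ring
      have hx := hroot ((-(b - a) + d) / (2 * a)) (by rw [hf, sub_self]; ring)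
      have hy := hroot ((-(b - a) - d) / (2 * a)) (by rw [hf, sub_self]; ring)
      refine ⟨2 / (ν - (-(b - a) + d) / (2 * a)), 2 / (ν - (-(b - a) - d) / (2 * a)),
        div_nonneg (by norm_num) (by linarith), div_nonneg (by norm_num) (by linarith),
        fun k => ?_⟩
      rw [key _ _ hx, key _ _ hy, hf, hf]
      have h1 : ν - (-(b - a) + d) / (2 * a) ≠ 0 := by linarith
      have h2 : ν - (-(b - a) - d) / (2 * a) ≠ 0 := by linarith
      generalize (-(b - a) + d) / (2 * a) = x at *
      generalize (-(b - a) - d) / (2 * a) = y at *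
      field_simp
    · have hba : 0 < b - a := by linarith
      have hQ : 0 < mercerQ a b c ν := by
        have h1 : mercerQ a b c ν = a * ν ^ 2 + (b - a) * ν + c := by
          simp only [mercerQ]
          ring
        rw [h1]
        positivity
      -- Here `Q` may have nonreal roots. The Bessel recurrence `4 k (ν + k) b_k = -b_(k-1)` trades
      -- the `k²` term of the weight for a shift, leaving a first-order operator; `a < b` and `0 ≤
      -- a` make its parameters nonnegative.
      obtain ⟨V, τ, hV, -⟩ := hU.exists_operator
        (s := 2 * (b - a) / mercerQ a b c ν) (b := a / mercerQ a b c ν)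
        (g := fun k => (1 + (4 * a * ν + 2 * (b - a)) / mercerQ a b c ν * k +
          4 * a / mercerQ a b c ν * k ^ 2) * besselCoeff ν k) (by positivity) (by positivity)
        (by simp [hU.coeff_zero]) (by
          intro k
          have h1 := besselCoeff_succ hν k
          push_cast
          field_simp
          linear_combination a * h1)
      refine ⟨(4 * a * ν + 2 * (b - a)) / mercerQ a b c ν, 4 * a / mercerQ a b c ν,
        by positivity, by positivity, fun k => ?_, V, τ, hV⟩
      have h1 : mercerQ a b c ν * (1 + (4 * a * ν + 2 * (b - a)) / mercerQ a b c ν * k +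
          4 * a / mercerQ a b c ν * k ^ 2) =
          mercerQ a b c ν + (4 * a * ν + 2 * (b - a)) * k + 4 * a * k ^ 2 := by
        field_simp
      rw [h1]
      simp only [mercerQ]
      ring

/-! ### Reduction of `N_ν`, `g_ν` and `h_ν` to power series. -/

/-- Dividing by a positive real leaves the argument unchanged, so the identity also holds on the
branch cut. -/
theorem half_cpow {ν : ℝ} (k : ℕ) {w : ℂ} (hw : w ≠ 0) :
    (w / 2) ^ ((2 * k + ν : ℝ) : ℂ) = (w ^ 2) ^ k * w ^ (ν : ℂ) / (4 ^ k * ((2 ^ ν : ℝ) : ℂ)) := by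
  have hw2 : w / 2 ≠ 0 := by simpa using hw
  have h1 : (w / 2) ^ (ν : ℂ) = w ^ (ν : ℂ) / ((2 ^ ν : ℝ) : ℂ) := by
    have h2 : Complex.log (w / 2) = Complex.log w - Real.log 2 := by
      have := Complex.log_ofReal_mul (r := 1 / 2) (by norm_num) hw
      rw [one_div, Real.log_inv] at this
      rw [div_eq_inv_mul]
      push_cast at this ⊢
      rw [this]
      ring
    rw [Complex.cpow_def_of_ne_zero hw2, Complex.cpow_def_of_ne_zero hw, h2, sub_mul,
      Complex.exp_sub, Real.rpow_def_of_pos (by norm_num), Complex.ofReal_exp, Complex.ofReal_mul]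
  rw [Complex.ofReal_add, Complex.cpow_add _ _ hw2, h1]
  have h3 : ((2 * k : ℝ) : ℂ) = ((2 * k : ℕ) : ℂ) := by push_cast; ring
  rw [h3, Complex.cpow_natCast, pow_mul, div_pow, div_pow]
  norm_num
  ring

section

variable {a b c ν A B : ℝ}

theorem mercerN_eq_powerSum (hν : 0 < ν)
    (hQ : ∀ k : ℕ, mercerQ a b c (2 * k + ν) = mercerQ a b c ν * (1 + A * k + B * k ^ 2))
    {w : ℂ} (hw : w ≠ 0) :
    mercerN a b c ν w = ((mercerQ a b c ν / (2 ^ ν * Real.Gamma (ν + 1)) : ℝ) : ℂ) *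
      w ^ (ν : ℂ) * powerSum (fun k => (1 + A * k + B * k ^ 2) * besselCoeff ν k) (w ^ 2) := by
  rw [mercerN, powerSum, ← tsum_mul_left]
  refine tsum_congr fun k => ?_
  have hG : ((Real.Gamma (ν + 1) : ℝ) : ℂ) ≠ 0 :=
    Complex.ofReal_ne_zero.mpr (Real.Gamma_pos_of_pos (by linarith)).ne'
  have hR : ((risingProd ν k : ℝ) : ℂ) ≠ 0 := Complex.ofReal_ne_zero.mpr (risingProd_pos hν k).ne'
  have h2 : ((2 ^ ν : ℝ) : ℂ) ≠ 0 :=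
    Complex.ofReal_ne_zero.mpr (Real.rpow_pos_of_pos (by norm_num) _).ne'
  have hk : (k.factorial : ℂ) ≠ 0 := by exact_mod_cast k.factorial_ne_zero
  rw [half_cpow k hw, hQ, gamma_add_natCast hν, besselCoeff]
  simp only [Complex.ofReal_div, Complex.ofReal_mul, Complex.ofReal_pow, Complex.ofReal_neg,
    Complex.ofReal_one, Complex.ofReal_natCast, Complex.ofReal_ofNat]
  field_simp

theorem mercer_const_mul (hν : 0 < ν) (hne : mercerQ a b c ν ≠ 0) :
    ((2 ^ ν * Real.Gamma (ν + 1) / mercerQ a b c ν : ℝ) : ℂ) *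
      ((mercerQ a b c ν / (2 ^ ν * Real.Gamma (ν + 1)) : ℝ) : ℂ) = 1 := by
  have hG : Real.Gamma (ν + 1) ≠ 0 := (Real.Gamma_pos_of_pos (by linarith)).ne'
  have h2 : (2 : ℝ) ^ ν ≠ 0 := (Real.rpow_pos_of_pos (by norm_num) _).ne'
  rw [← Complex.ofReal_mul, ← Complex.ofReal_one]
  congr 1
  field_simp

theorem mercerN_zero (hν : 0 < ν) : mercerN a b c ν 0 = 0 := by
  rw [mercerN]
  convert tsum_zero with k
  have : ((2 * k + ν : ℝ) : ℂ) ≠ 0 := Complex.ofReal_ne_zero.mpr (by positivity)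
  rw [zero_div, Complex.zero_cpow this, mul_zero]

theorem mercerG_eq (hν : 0 < ν) (hne : mercerQ a b c ν ≠ 0)
    (hQ : ∀ k : ℕ, mercerQ a b c (2 * k + ν) = mercerQ a b c ν * (1 + A * k + B * k ^ 2)) :
    mercerG a b c ν =
      fun z => z * powerSum (fun k => (1 + A * k + B * k ^ 2) * besselCoeff ν k) (z ^ 2) := by
  ext z
  by_cases hz : z = 0
  · rw [hz, mercerG, mercerN_zero hν, mul_zero, zero_mul]
  · have h1 : z ^ ((1 - ν : ℝ) : ℂ) * z ^ (ν : ℂ) = z := by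
      rw [← Complex.cpow_add _ _ hz, ← Complex.ofReal_add, sub_add_cancel, Complex.ofReal_one,
        Complex.cpow_one]
    rw [mercerG, mercerN_eq_powerSum hν hQ hz]
    set P := powerSum (fun k => (1 + A * k + B * k ^ 2) * besselCoeff ν k) (z ^ 2)
    linear_combination z ^ ((1 - ν : ℝ) : ℂ) * z ^ (ν : ℂ) * P * mercer_const_mul hν hne + P * h1

theorem mercerH_eq (hν : 0 < ν) (hne : mercerQ a b c ν ≠ 0)
    (hQ : ∀ k : ℕ, mercerQ a b c (2 * k + ν) = mercerQ a b c ν * (1 + A * k + B * k ^ 2)) :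
    mercerH a b c ν =
      fun z => z * powerSum (fun k => (1 + A * k + B * k ^ 2) * besselCoeff ν k) (z ^ 1) := by
  ext z
  by_cases hz : z = 0
  · rw [hz, mercerH, Complex.zero_cpow (show (1 / 2 : ℂ) ≠ 0 by norm_num), mercerN_zero hν, mul_zero, zero_mul]
  · have hw : z ^ (1 / 2 : ℂ) ≠ 0 := by simp [Complex.cpow_eq_zero_iff, hz]
    have hw2 : (z ^ (1 / 2 : ℂ)) ^ 2 = z ^ 1 := by
      rw [← Complex.cpow_nat_mul]
      norm_num
    have him : (Complex.log z * (1 / 2 : ℂ)).im = z.arg / 2 := by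
      have : (1 / 2 : ℂ) = ((1 / 2 : ℝ) : ℂ) := by push_cast; ring
      rw [this, Complex.im_mul_ofReal, Complex.log_im]
      ring
    -- Halving the argument keeps it in `(-π, π]`, so the principal powers compose.
    have hwν : (z ^ (1 / 2 : ℂ)) ^ (ν : ℂ) = z ^ ((ν / 2 : ℝ) : ℂ) := by
      rw [← Complex.cpow_mul]
      · congr 1
        push_cast
        ring
      · rw [him]
        linarith [Complex.neg_pi_lt_arg z, Real.pi_pos]
      · rw [him]
        linarith [Complex.arg_le_pi z, Real.pi_pos]
    have h1 : z ^ ((1 - ν / 2 : ℝ) : ℂ) * z ^ ((ν / 2 : ℝ) : ℂ) = z := by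
      rw [← Complex.cpow_add _ _ hz, ← Complex.ofReal_add, sub_add_cancel, Complex.ofReal_one,
        Complex.cpow_one]
    rw [mercerH, mercerN_eq_powerSum hν hQ hw, hw2, hwν]
    set P := powerSum (fun k => (1 + A * k + B * k ^ 2) * besselCoeff ν k) (z ^ 1)
    linear_combination z ^ ((1 - ν / 2 : ℝ) : ℂ) * z ^ ((ν / 2 : ℝ) : ℂ) * P *
      mercer_const_mul hν hne + P * h1

end

/-! ### The radius of starlikeness and the explicit bounds. -/

/-- The radius of starlikeness of `z f(z ^ m)` is the `m`-th root of the first zero of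
`f + m z f'`. -/
theorem IsPosProdLimit.starlikeRadius_eq {U : ℕ → Multiset ℝ} {f σ : ℕ → ℝ}
    (h : IsPosProdLimit U f σ) {m : ℕ} (hm : m ≠ 0) {ρ : ℝ} (hρ : 0 < ρ)
    (hF0 : realPowerSum (fun k => (1 + (m : ℝ) * k) * f k) (ρ ^ m) = 0)
    (hF : ∀ t ∈ Set.Ico 0 (ρ ^ m), 0 < realPowerSum (fun k => (1 + (m : ℝ) * k) * f k) t)
    (hT : ∀ t ∈ Set.Ico 0 (ρ ^ m), 0 < realPowerSum f t) :
    starlikeRadius 0 (fun z => z * powerSum f (z ^ m)) = ρ := by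
  have hsum : ∀ r : ℝ, 0 ≤ r → Summable fun k => |f k| * r ^ k := fun r hr => h.summable hr
  obtain ⟨V, τ, hV, -⟩ := h.exists_euler (Nat.cast_nonneg m : (0 : ℝ) ≤ m)
  have hder : ∀ z : ℂ, HasDerivAt (fun z => z * powerSum f (z ^ m))
      (powerSum (fun k => (1 + (m : ℝ) * k) * f k) (z ^ m)) z := by
    intro z
    obtain ⟨d, hd, hd'⟩ := hasDerivAt_powerSum hsum (z ^ m)
    refine ((hasDerivAt_id z).mul (hd.comp z (hasDerivAt_pow m z))).congr_deriv ?_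
    have hs2 : Summable fun k : ℕ => (((k * f k : ℝ)) : ℂ) * (z ^ m) ^ k := by
      have h1 := (summable_powerSum (fun r hr => hV.summable hr) (z ^ m)).sub
        (summable_powerSum hsum (z ^ m))
      have hm0 : (m : ℂ) ≠ 0 := by exact_mod_cast hm
      refine (h1.mul_left (m : ℂ)⁻¹).congr fun k => ?_
      push_cast
      field_simp
      ring
    have hsplit : powerSum (fun k => (1 + (m : ℝ) * k) * f k) (z ^ m) =
        powerSum f (z ^ m) + m * powerSum (fun k => k * f k) (z ^ m) := by
      rw [powerSum, powerSum, powerSum, ← tsum_mul_left,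
        ← (summable_powerSum hsum (z ^ m)).tsum_add (hs2.mul_left _)]
      refine tsum_congr fun k => ?_
      push_cast
      ring
    have hz : z ^ (m - 1) * z = z ^ m := pow_sub_one_mul hm z
    rw [hsplit, ← hd']
    simp only [id, Function.comp]
    linear_combination m * d * hz
  have hgreat : IsGreatest {r : ℝ | 0 < r ∧
      DifferentiableOn ℂ (fun z => z * powerSum f (z ^ m)) (Metric.ball 0 r) ∧
      ∀ z ∈ Metric.ball (0 : ℂ) r, z ≠ 0 → 0 < (z * deriv (fun z => z * powerSum f (z ^ m)) z /
        (z * powerSum f (z ^ m))).re} ρ := by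
    refine ⟨⟨hρ, fun z _ => (hder z).differentiableAt.differentiableWithinAt,
      fun z hz hz0 => ?_⟩, ?_⟩
    · have hlt : ‖z ^ m‖ < ρ ^ m := by
        rw [norm_pow]
        exact pow_lt_pow_left₀ (mem_ball_zero_iff.mp hz) (norm_nonneg _) hm
      rw [(hder z).deriv, mul_div_mul_left _ _ hz0]
      exact h.euler_div_re_pos (Nat.cast_nonneg m)
        (fun t ht => hT t ⟨ht.1, lt_of_le_of_lt ht.2 hlt⟩) (hF _ ⟨norm_nonneg _, hlt⟩)
    -- A larger disk contains `z = ρ`, where the numerator vanishes and the quotient is `0`.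
    · rintro r ⟨hr, -, hpos⟩
      by_contra! hlt
      have := hpos (ρ : ℂ) (by simpa [abs_of_pos hρ] using hlt) (by exact_mod_cast hρ.ne')
      rw [(hder _).deriv, ← Complex.ofReal_pow, powerSum_ofReal, hF0] at this
      simp at this
  exact hgreat.csSup_eq

/-- The Euler–Rayleigh inequalities for the radius of starlikeness `ρ` of `z T(z ^ m)`, where `T`
is the normalized series of `N_ν`; here `p k` are the power sums of the inverse zeros of
`T + m z T'`. -/
theorem exists_mercer_radius {ν A B : ℝ} (hν : 0 < ν) (hA : 0 ≤ A) (hB : 0 ≤ B)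
    {U : ℕ → Multiset ℝ} {σ : ℕ → ℝ}
    (h : IsPosProdLimit U (fun k => (1 + A * k + B * k ^ 2) * besselCoeff ν k) σ)
    {m : ℕ} (hm : m ≠ 0) :
    ∃ ρ p₁ p₂ p₃ : ℝ, 0 < ρ ∧ starlikeRadius 0 (fun z =>
        z * powerSum (fun k => (1 + A * k + B * k ^ 2) * besselCoeff ν k) (z ^ m)) = ρ ∧
      0 < p₁ ∧ 0 < p₂ ∧ 0 < p₃ ∧ 1 < p₁ * ρ ^ m ∧ 1 < p₂ * (ρ ^ m) ^ 2 ∧ ρ ^ m * p₂ < p₁ ∧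
      ρ ^ m * p₃ < p₂ ∧ m * (1 + A + B) * ρ ^ m < 4 * (ν + 1) ∧
      4 * (ν + 1) * p₁ = (1 + m) * (1 + A + B) ∧
      16 * (ν + 1) ^ 2 * (ν + 2) * p₂ = (1 + m) ^ 2 * (ν + 2) * (1 + A + B) ^ 2 -
        (1 + 2 * m) * (ν + 1) * (1 + 2 * A + 4 * B) ∧
      128 * (ν + 1) ^ 3 * (ν + 2) * (ν + 3) * p₃ =
        2 * (1 + m) ^ 3 * (ν + 2) * (ν + 3) * (1 + A + B) ^ 3 -
        3 * (1 + m) * (1 + 2 * m) * (ν + 1) * (ν + 3) * (1 + A + B) * (1 + 2 * A + 4 * B) +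
        (1 + 3 * m) * (ν + 1) ^ 2 * (1 + 3 * A + 9 * B) := by
  set f : ℕ → ℝ := fun k => (1 + A * k + B * k ^ 2) * besselCoeff ν k with hf
  have hm0 : (0 : ℝ) < m := by positivity
  obtain ⟨V, τ, hV, -⟩ := h.exists_euler hm0.le
  obtain ⟨hw, hD⟩ := quadratic_weight hA hB hm0.le
  obtain ⟨hpos, hC⟩ := besselCoeff_weight hν hw hD
  -- The weight with `s = 0` belongs to `T` itself, the one with `s = m` to `F`.
  obtain ⟨hw', hD'⟩ := quadratic_weight hA hB le_rfl
  obtain ⟨hpos', hC'⟩ := besselCoeff_weight hν hw' hD'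
  simp only [zero_mul, add_zero, one_mul] at hpos' hC'
  simp only [mul_assoc (1 + (m : ℝ) * _)] at hpos hC
  obtain ⟨y, hy, hy0, hyF, h1, h2, h3, h4, h5, h6, h7⟩ := hV.exists_first_zero hpos hC
  obtain ⟨hT, hE⟩ := h.first_zero_euler hpos' hC' hm0 hy hyF
  obtain ⟨ρ, hρ, rfl⟩ : ∃ ρ : ℝ, 0 < ρ ∧ ρ ^ m = y :=
    ⟨y ^ ((m : ℝ)⁻¹), by positivity, Real.rpow_inv_natCast_pow hy.le hm⟩
  have b0 : besselCoeff ν 0 = 1 := by simp [besselCoeff, risingProd]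
  have b1 := besselCoeff_succ hν 0
  have b2 := besselCoeff_succ hν 1
  have b3 := besselCoeff_succ hν 2
  norm_num [b0] at b1 b2 b3
  have n2 : ν + 1 + 1 = ν + 2 := by ring
  have n3 : ν + 1 + 2 = ν + 3 := by ring
  rw [n2] at b2
  rw [n3] at b3
  have p1 : (0 : ℝ) < ν + 1 := by positivity
  have p2 : (0 : ℝ) < ν + 2 := by positivity
  have p3 : (0 : ℝ) < ν + 3 := by positivity
  have c1 : besselCoeff ν 1 = -1 / (4 * (ν + 1)) := by
    field_simp
    linarith
  have c2 : besselCoeff ν 2 = 1 / (32 * (ν + 1) * (ν + 2)) := by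
    rw [c1] at b2
    field_simp at b2 ⊢
    linarith
  have c3 : besselCoeff ν 3 = -1 / (384 * (ν + 1) * (ν + 2) * (ν + 3)) := by
    rw [c2] at b3
    field_simp at b3 ⊢
    linarith
  refine ⟨ρ, τ 1, τ 2, τ 3, hρ, h.starlikeRadius_eq hm hρ hy0 hyF hT, h1, h2, h3, h4, h5, h6, h7,
    ?_, ?_, ?_, ?_⟩
  · rw [h.newton_one, hf] at hE
    simp only [c1] at hE
    norm_num at hE
    rw [← div_lt_one (by positivity)]
    refine lt_of_eq_of_lt ?_ hE
    ring
  · rw [hV.newton_one]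
    simp only [hf, c1]
    norm_num
    field_simp
  · rw [hV.newton_two]
    simp only [hf, c1, c2]
    norm_num
    field_simp
    ring
  · rw [hV.newton_three]
    simp only [hf, c1, c2, c3]
    norm_num
    field_simp
    ring

theorem theorem4 (a b c ν : ℝ)
    (habc : (c = 0 ∧ a ≠ b) ∨ (0 < c ∧ a < b))
    (hν : 0 < ν) (hroot : ∀ x : ℝ, mercerQ a b c x = 0 → x < ν) :
    (starlikeRadius 0 (mercerG a b c ν) <
        Real.sqrt (2 * (ν + 1) * mercerQ a b c ν / mercerQ a b c (ν + 2)) ∧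
      2 * Real.sqrt ((ν + 1) * mercerQ a b c ν / (3 * mercerQ a b c (ν + 2))) <
        starlikeRadius 0 (mercerG a b c ν) ∧
      starlikeRadius 0 (mercerG a b c ν) <
        2 * Real.sqrt (mercerQ a b c (ν + 2) /
          (3 * mercerQ a b c (ν + 2) ^ 2 / ((ν + 1) * mercerQ a b c ν) -
            5 * mercerQ a b c (ν + 4) / (3 * (ν + 2)))) ∧
      (16 * (ν + 1) ^ 2 * (ν + 2) * mercerQ a b c ν ^ 2 /
          (9 * (ν + 2) * mercerQ a b c (ν + 2) ^ 2 -
            5 * (ν + 1) * mercerQ a b c ν * mercerQ a b c (ν + 4))) ^ (1 / 4 : ℝ) <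
        starlikeRadius 0 (mercerG a b c ν) ∧
      starlikeRadius 0 (mercerG a b c ν) <
        Real.sqrt (8 * (ν + 1) * (ν + 3) * mercerQ a b c ν *
            (9 * (ν + 2) * mercerQ a b c (ν + 2) ^ 2 -
              5 * (ν + 1) * mercerQ a b c ν * mercerQ a b c (ν + 4)) /
          (9 * (ν + 3) * mercerQ a b c (ν + 2) *
              (6 * (ν + 2) * mercerQ a b c (ν + 2) ^ 2 -
                5 * (ν + 1) * mercerQ a b c ν * mercerQ a b c (ν + 4)) +
            7 * (ν + 1) ^ 2 * mercerQ a b c ν ^ 2 * mercerQ a b c (ν + 6)))) ∧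
    (starlikeRadius 0 (mercerH a b c ν) <
        4 * (ν + 1) * mercerQ a b c ν / mercerQ a b c (ν + 2) ∧
      2 * (ν + 1) * mercerQ a b c ν / (3 * mercerQ a b c (ν + 2)) <
        starlikeRadius 0 (mercerH a b c ν) ∧
      2 * (ν + 1) * mercerQ a b c ν / mercerQ a b c (ν + 2) <
        starlikeRadius 0 (mercerH a b c ν) ∧
      starlikeRadius 0 (mercerH a b c ν) <
        2 * mercerQ a b c (ν + 2) /
          (mercerQ a b c (ν + 2) ^ 2 / ((ν + 1) * mercerQ a b c ν) -
            3 * mercerQ a b c (ν + 4) / (4 * (ν + 2))) ∧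
      Real.sqrt (4 * (ν + 1) * mercerQ a b c ν /
          (mercerQ a b c (ν + 2) ^ 2 / ((ν + 1) * mercerQ a b c ν) -
            3 * mercerQ a b c (ν + 4) / (4 * (ν + 2)))) <
        starlikeRadius 0 (mercerH a b c ν) ∧
      starlikeRadius 0 (mercerH a b c ν) <
        4 * (ν + 1) * (ν + 3) * mercerQ a b c ν *
            (4 * (ν + 2) * mercerQ a b c (ν + 2) ^ 2 -
              3 * (ν + 1) * mercerQ a b c ν * mercerQ a b c (ν + 4)) /
          ((ν + 3) * mercerQ a b c (ν + 2) *
              (8 * (ν + 2) * mercerQ a b c (ν + 2) ^ 2 -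
                9 * (ν + 1) * mercerQ a b c ν * mercerQ a b c (ν + 4)) +
            2 * (ν + 1) ^ 2 * mercerQ a b c ν ^ 2 * mercerQ a b c (ν + 6))) := by
  obtain ⟨hQ0, A, B, hA, hB, hQ, U, σ, hU⟩ := exists_mercer_limit habc hν hroot
  rw [mercerG_eq hν hQ0 hQ, mercerH_eq hν hQ0 hQ]
  have hQ1 : mercerQ a b c (ν + 2) = mercerQ a b c ν * (1 + A + B) := by
    have := hQ 1
    norm_num at this
    rw [add_comm, this]
  have hQ2 : mercerQ a b c (ν + 4) = mercerQ a b c ν * (1 + 2 * A + 4 * B) := by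
    have := hQ 2
    norm_num at this
    rw [add_comm, this]
    ring
  have hQ3 : mercerQ a b c (ν + 6) = mercerQ a b c ν * (1 + 3 * A + 9 * B) := by
    have := hQ 3
    norm_num at this
    rw [add_comm, this]
    ring
  rw [hQ1, hQ2, hQ3]
  obtain ⟨ρ, p₁, p₂, p₃, hρ, hr, h1, h2, h3, l1, l2, u1, u2, u0, e1, e2, e3⟩ :=
    exists_mercer_radius hν hA hB hU two_ne_zero
  obtain ⟨ρ', p₁', p₂', p₃', hρ', hr', h1', h2', h3', l1', l2', u1', u2', u0', e1', e2', e3'⟩ :=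
    exists_mercer_radius hν hA hB hU one_ne_zero
  rw [hr, hr']
  have hq1 : 0 < 1 + A + B := by positivity
  -- `Q(ν)` may be negative; `Q ≠ 0` suffices because each bound is homogeneous of degree `0` in the
  -- values of `Q`.
  generalize mercerQ a b c ν = Q at hQ0
  generalize 1 + A + B = q at *
  generalize 1 + 2 * A + 4 * B = r at *
  generalize 1 + 3 * A + 9 * B = t at *
  have k1 : 0 < ν + 1 := by positivity
  have k2 : 0 < ν + 2 := by positivity
  have k3 : 0 < ν + 3 := by positivity
  push_cast at e1 e2 e3 u0 e1' e2' e3' u0'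
  rw [pow_one] at l1' l2' u1' u2' u0'
  -- With `y = ρ ^ 2` in the first group and `y = ρ'` in the second, the bounds are `m * σ 1 * y <
  -- 1`, `1 / p₁ < y`, `y < p₁ / p₂`, `1 / p₂ < y ^ 2` and `y < p₂ / p₃`, in this order. The second
  -- group has one more, the weaker `1 / (3 * p₁') < ρ'`, in second place.
  refine ⟨⟨?_, ?_, ?_, ?_, ?_⟩, ?_, ?_, ?_, ?_, ?_, ?_⟩
  · have : 2 * (ν + 1) * Q / (Q * q) = 2 * (ν + 1) / q := by field_simp
    rw [this]
    apply Real.lt_sqrt_of_sq_lt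
    rw [lt_div_iff₀ hq1]
    linarith
  · have : (ν + 1) * Q / (3 * (Q * q)) = 1 / (4 * p₁) := by
      have hq : q = 4 * (ν + 1) * p₁ / 3 := by linarith
      rw [hq]
      field_simp
    rw [this, ← lt_div_iff₀' two_pos, Real.sqrt_lt' (by positivity), div_lt_iff₀ (by positivity)]
    linarith
  · have hD : 3 * (Q * q) ^ 2 / ((ν + 1) * Q) - 5 * (Q * r) / (3 * (ν + 2)) =
        Q * (16 * (ν + 1) * p₂ / 3) := by
      field_simp
      linear_combination -e2
    have : Q * q / (Q * (16 * (ν + 1) * p₂ / 3)) = p₁ / (4 * p₂) := by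
      have hq : q = 4 * (ν + 1) * p₁ / 3 := by linarith
      rw [hq]
      field_simp
      ring
    rw [hD, this, ← div_lt_iff₀' two_pos]
    apply Real.lt_sqrt_of_sq_lt
    rw [lt_div_iff₀ (by positivity)]
    linarith
  · have hD : 9 * (ν + 2) * (Q * q) ^ 2 - 5 * (ν + 1) * Q * (Q * r) =
        Q ^ 2 * (16 * (ν + 1) ^ 2 * (ν + 2) * p₂) := by
      linear_combination -Q ^ 2 * e2
    have : 16 * (ν + 1) ^ 2 * (ν + 2) * Q ^ 2 / (Q ^ 2 * (16 * (ν + 1) ^ 2 * (ν + 2) * p₂)) =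
        1 / p₂ := by field_simp
    rw [hD, this]
    have h4 : 1 / p₂ < ρ ^ 4 := by
      rw [div_lt_iff₀ h2]
      linarith
    calc (1 / p₂) ^ (1 / 4 : ℝ) < (ρ ^ 4) ^ (1 / 4 : ℝ) := by gcongr
      _ = ρ := by
        have := Real.pow_rpow_inv_natCast hρ.le (n := 4) (by norm_num)
        rw [one_div]
        exact_mod_cast this
  · have hD : 9 * (ν + 2) * (Q * q) ^ 2 - 5 * (ν + 1) * Q * (Q * r) =
        Q ^ 2 * (16 * (ν + 1) ^ 2 * (ν + 2) * p₂) := by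
      linear_combination -Q ^ 2 * e2
    have hN : 9 * (ν + 3) * (Q * q) * (6 * (ν + 2) * (Q * q) ^ 2 - 5 * (ν + 1) * Q * (Q * r)) +
        7 * (ν + 1) ^ 2 * Q ^ 2 * (Q * t) =
        Q ^ 3 * (128 * (ν + 1) ^ 3 * (ν + 2) * (ν + 3) * p₃) := by
      linear_combination -Q ^ 3 * e3
    have : 8 * (ν + 1) * (ν + 3) * Q * (Q ^ 2 * (16 * (ν + 1) ^ 2 * (ν + 2) * p₂)) /
        (Q ^ 3 * (128 * (ν + 1) ^ 3 * (ν + 2) * (ν + 3) * p₃)) = p₂ / p₃ := by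
      field_simp
      norm_num
    rw [hD, hN, this]
    apply Real.lt_sqrt_of_sq_lt
    rw [lt_div_iff₀ h3]
    exact u2
  · have : 4 * (ν + 1) * Q / (Q * q) = 4 * (ν + 1) / q := by field_simp
    rw [this, lt_div_iff₀ hq1]
    linarith
  · have : 2 * (ν + 1) * Q / (3 * (Q * q)) = 1 / (3 * p₁') := by
      have hq : q = 2 * (ν + 1) * p₁' := by linarith
      rw [hq]
      field_simp
    rw [this, div_lt_iff₀ (by positivity)]
    linarith
  · have : 2 * (ν + 1) * Q / (Q * q) = 1 / p₁' := by
      have hq : q = 2 * (ν + 1) * p₁' := by linarith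
      rw [hq]
      field_simp
    rw [this, div_lt_iff₀ h1']
    linarith
  all_goals
    have hD : (Q * q) ^ 2 / ((ν + 1) * Q) - 3 * (Q * r) / (4 * (ν + 2)) =
        Q * (4 * (ν + 1) * p₂') := by
      field_simp
      linear_combination -e2'
  · have : 2 * (Q * q) / (Q * (4 * (ν + 1) * p₂')) = p₁' / p₂' := by
      have hq : q = 2 * (ν + 1) * p₁' := by linarith
      rw [hq]
      field_simp
      norm_num
    rw [hD, this, lt_div_iff₀ h2']
    exact u1'
  · have : 4 * (ν + 1) * Q / (Q * (4 * (ν + 1) * p₂')) = 1 / p₂' := by field_simp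
    rw [hD, this, Real.sqrt_lt' hρ', div_lt_iff₀ h2']
    linarith
  · have hD' : 4 * (ν + 2) * (Q * q) ^ 2 - 3 * (ν + 1) * Q * (Q * r) =
        Q ^ 2 * (16 * (ν + 1) ^ 2 * (ν + 2) * p₂') := by
      linear_combination -Q ^ 2 * e2'
    have hN : (ν + 3) * (Q * q) * (8 * (ν + 2) * (Q * q) ^ 2 - 9 * (ν + 1) * Q * (Q * r)) +
        2 * (ν + 1) ^ 2 * Q ^ 2 * (Q * t) =
        Q ^ 3 * (64 * (ν + 1) ^ 3 * (ν + 2) * (ν + 3) * p₃') := by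
      linear_combination -Q ^ 3 * e3' / 2
    have : 4 * (ν + 1) * (ν + 3) * Q * (Q ^ 2 * (16 * (ν + 1) ^ 2 * (ν + 2) * p₂')) /
        (Q ^ 3 * (64 * (ν + 1) ^ 3 * (ν + 2) * (ν + 3) * p₃')) = p₂' / p₃' := by
      field_simp
      norm_num
    rw [hD', hN, this, lt_div_iff₀ h3']
    exact u2'
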